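/- Let $G$ be a (finite-dimensional, real, smooth) Lie group with Lie algebra $\mathfrak g=T_1G$, left Maurer--Cartan form $\lambda$, and a vector space decomposition $\mathfrak g=\mathfrak a\oplus\mathfrak b$ (for example the one induced by a factorization $G=AB$), so that $\mathfrak g^*=\mathfrak a^0\oplus\mathfrak b^0$ with projections $\pi_{\mathfrak a^0},\pi_{\mathfrak b^0}$, where $(\cdot)^0$ denotes the annihilator. Let $\mathsf B$ be a symmetric bilinear form on $\mathfrak g$, write $\xi^\flat=\mathsf B(\xi,\cdot)$, $(\mathrm{ad}^\sharp_\kappa\phi)(\xi)=\phi([\xi,\kappa])$, $(\mathrm{Ad}^\sharp_g\phi)(\xi)=\phi(\mathrm{Ad}_{g^{-1}}\xi)$, and assume the invariance $\mathrm{ad}^\sharp_\zeta\zeta^\flat=0$ for all $\zeta\in\mathfrak g$. Let $\mu\in\mathfrak b^0$, $\nu\in\mathfrak a^0$, and let $I\subseteq\mathbb R$ be open (e.g. an open interval). Let $\Lambda=TG\oplus(G\times\mathfrak a)\oplus(G\times\mathfrak b)$, with $TG$ left trivialized and points $(g,J;\alpha,\beta)$, and on $I\times\Lambda$ put $$\theta=\lambda-(J-\mathrm{Ad}_{g^{-1}}\alpha-\beta)\,dt,\qquad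 L_{\mu\nu}=\tfrac12\mathsf B(J,J)-\mu(\alpha)-\nu(\beta).$$ For a bundle $X\to I$, a one-form $\omega$ on $X$ and an exterior differential system on $X$ generated by the components of a vector-valued one-form $\vartheta$, the extremals of $(X,\omega,\langle\vartheta\rangle)$ are the smooth sections $\gamma$ with $\gamma^*\vartheta=0$ at which the action $\int\gamma^*\omega$ is stationary under all smooth compactly supported variations $\gamma_s$ through sections that are admissible, i.e. $\frac{d}{ds}\big|_{s=0}\gamma_s^*\vartheta=0$. Let $\tilde\Lambda=\Lambda\times\mathfrak g^*$, let $\Pi:I\times\tilde\Lambda\to I\times\Lambda$ be the map forgetting $\sigma\in\mathfrak g^*$, and let $\tilde\lambda=L_{\mu\nu}\,dt+\sigma(\theta)$ on $I\times\tilde\Lambda$. Then: 1. $(\tilde\Lambda,\tilde\lambda,0)$ is a Lepagean equivalent of $(\Lambda,L_{\mu\nu}dt,\langle\theta\rangle)$ through $\Pi$: $\Pi$ is a surjective submersion over $I$, and $\gamma^*\tilde\lambda=(\Pi\circ\gamma)^*(L_{\mu\nu}dt)$ for every section $\gamma$ of $I\times\tilde\Lambda$ with $(\Pi\circ\gamma)^*\theta=0$.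 It is the canonical one: for every $p\in I\times\Lambda$, $\sigma\mapsto L_{\mu\nu}dt|_p+\sigma\circ\theta|_p$ is a bijection of $\mathfrak g^*$ onto the affine space of the covectors $L_{\mu\nu}dt|_p+\beta$ with $\beta$ in the span of the components of $\theta|_p$. 2. $\gamma\mapsto\Pi\circ\gamma$ is a bijection from the extremals of $(\tilde\Lambda,\tilde\lambda,0)$ onto the extremals of $(\Lambda,L_{\mu\nu}dt,\langle\theta\rangle)$. In particular this Lepagean equivalent is bivariant: the projection of each of its extremals is an extremal (covariance), and every extremal of $(\Lambda,L_{\mu\nu}dt,\langle\theta\rangle)$ is such a projection (contravariance). 3. The extremals of $(\tilde\Lambda,\tilde\lambda,0)$ are exactly the integral sections of the exterior differential system generated by $$d\sigma+\mathrm{ad}^\sharp_{\lambda+\mathrm{Ad}_{g^{-1}}\alpha\,dt}\sigma,\quad J^\flat-\sigma,\quad \theta,\quad \pi_{\mathfrak b^0}(\mathrm{Ad}^\sharp_g\sigma)-\mu,\quad \pi_{\mathfrak a^0}(\sigma)-\nu,$$ and the extremals of $(\Lambda,L_{\mu\nu}dt,\langle\theta\rangle)$ are exactly the solutions of its Euler--Lagrange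 equations, i.e. the integral sections of the system generated by $$dJ^\flat-\mathrm{ad}^\sharp_{\beta\,dt}J^\flat,\quad \theta,\quad \pi_{\mathfrak b^0}(\mathrm{Ad}^\sharp_gJ^\flat)-\mu,\quad \pi_{\mathfrak a^0}(J^\flat)-\nu .$$ -/

import Mathlib

noncomputable section

open Set MeasureTheory TopologicalSpace
open scoped Manifold ContDiff

namespace AKS

/-! ### One-forms, sections and variational problems over an open set of times -/

section Variational

variable {T : Opens ℝ}
  {EX : Type*} [NormedAddCommGroup EX] [NormedSpace ℝ EX] {HX : Type*} [TopologicalSpace HX]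
  {EY : Type*} [NormedAddCommGroup EY] [NormedSpace ℝ EY] {HY : Type*} [TopologicalSpace HY]
  {X : Type*} [TopologicalSpace X] [ChartedSpace HX X]
  {Y : Type*} [TopologicalSpace Y] [ChartedSpace HY Y]
  {V : Type*} [NormedAddCommGroup V] [NormedSpace ℝ V]
  {W : Type*} [NormedAddCommGroup W] [NormedSpace ℝ W]

/-- `V`-valued one-forms on the manifold `X`. -/
abbrev OneForm (J : ModelWithCorners ℝ EX HX) (X : Type*) [TopologicalSpace X]
    [ChartedSpace HX X] (V : Type*) [NormedAddCommGroup V] [NormedSpace ℝ V] :=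
  ∀ x : X, TangentSpace J x →L[ℝ] V

/-- The velocity at time `t` of a curve defined on `T`. -/
def velocity (J : ModelWithCorners ℝ EX HX) (γ : T → X) (t : T) : TangentSpace J (γ t) :=
  mfderiv 𝓘(ℝ, ℝ) J γ t (1 : ℝ)

/-- The velocity of a curve in a normed space, as a vector of that space. -/
def vectorVelocity (f : T → V) (t : T) : V :=
  mfderiv 𝓘(ℝ, ℝ) 𝓘(ℝ, V) f t (1 : ℝ)

/-- The coefficient of `dt` in the pullback `γ^*η` of a one-form by a curve. -/
def pull {J : ModelWithCorners ℝ EX HX} (η : OneForm J X V) (γ : T → X) (t : T) : V :=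
  η (γ t) (velocity J γ t)

/-- A variational problem `(X → T, λ, 𝓘)` over a one-dimensional base `T ⊆ ℝ`: `form` is the
Lagrangian one-form `λ` and the exterior differential system `𝓘` is differentially generated by the
components of the vector-valued one-form `gen`. -/
structure VariationalProblem (T : Opens ℝ) (J : ModelWithCorners ℝ EX HX) (X : Type*)
    [TopologicalSpace X] [ChartedSpace HX X] (V : Type*) [NormedAddCommGroup V]
    [NormedSpace ℝ V] where
  proj : X → T
  form : OneForm J X ℝ
  gen : OneForm J X V

namespace VariationalProblem

variable {J : ModelWithCorners ℝ EX HX} {K : ModelWithCorners ℝ EY HY}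

/-- Smooth sections of the bundle `X → T`. -/
def IsSection (P : VariationalProblem T J X V) (γ : T → X) : Prop :=
  ContMDiff 𝓘(ℝ, ℝ) J ∞ γ ∧ ∀ t, P.proj (γ t) = t

/-- Integral sections of the exterior differential system. The pullback to the one-dimensional base
of the forms of degree at least two vanishes, so only the generators matter. -/
def IsIntegral (P : VariationalProblem T J X V) (γ : T → X) : Prop :=
  P.IsSection γ ∧ ∀ t, pull P.gen γ t = 0

/-- A smooth one-parameter family of sections `Γ s` with `Γ 0 = γ`, fixed outside the compact set
`C` of times. -/
structure IsVariation (P : VariationalProblem T J X V) (γ : T → X) (C : Set T)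
    (Γ : ℝ → T → X) : Prop where
  smooth : ContMDiff (𝓘(ℝ, ℝ).prod 𝓘(ℝ, ℝ)) J ∞ (fun p : ℝ × T => Γ p.1 p.2)
  isSection : ∀ s t, P.proj (Γ s t) = t
  start : Γ 0 = γ
  compact : IsCompact C
  fixed : ∀ s, ∀ t ∉ C, Γ s t = γ t

/-- A variation is admissible if `γ^*(𝓛_{δγ} θ) = 0`, where `δγ` is the variation field and `θ` the
generator of the system; that is, `Γ s` preserves `θ = 0` to first order in `s`. -/
def IsAdmissible (P : VariationalProblem T J X V) (Γ : ℝ → T → X) : Prop :=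
  ∀ t, HasDerivAt (fun s : ℝ => pull P.gen (Γ s) t) 0 0

/-- The extremals: the integral sections at which the action `∫ γ^*λ` is stationary under all
admissible variations of compact support. -/
def extremals (P : VariationalProblem T J X V) : Set (T → X) :=
  {γ | P.IsIntegral γ ∧ ∀ (C : Set T) (Γ : ℝ → T → X), P.IsVariation γ C Γ → P.IsAdmissible Γ →
    HasDerivAt (fun s : ℝ => ∫ t in C, pull P.form (Γ s) t
      ∂(Measure.comap ((↑) : T → ℝ) volume)) 0 0}

/-- The problem `Q`, with zero differential system, is a Lepagean equivalent of `P` through the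
surjective submersion `ν`. -/
structure IsLepageEquivalent (P : VariationalProblem T J X V) (Q : VariationalProblem T K Y W)
    (ν : Y → X) : Prop where
  gen_eq_zero : Q.gen = 0
  smooth : ContMDiff K J ∞ ν
  surjective : Function.Surjective ν
  submersion : ∀ y, Function.Surjective (mfderiv K J ν y)
  proj_eq : ∀ y, Q.proj y = P.proj (ν y)
  pull_eq : ∀ γ : T → Y, Q.IsSection γ → P.IsIntegral (ν ∘ γ) →
    ∀ t, pull Q.form γ t = pull P.form (ν ∘ γ) t

def IsCovariant (P : VariationalProblem T J X V) (Q : VariationalProblem T K Y W)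
    (ν : Y → X) : Prop :=
  ∀ γ ∈ Q.extremals, ν ∘ γ ∈ P.extremals

def IsContravariant (P : VariationalProblem T J X V) (Q : VariationalProblem T K Y W)
    (ν : Y → X) : Prop :=
  ∀ γ ∈ P.extremals, ∃ γ' ∈ Q.extremals, ν ∘ γ' = γ

def IsBivariant (P : VariationalProblem T J X V) (Q : VariationalProblem T K Y W)
    (ν : Y → X) : Prop :=
  IsCovariant P Q ν ∧ IsContravariant P Q ν

/-- The fibre over `x` of the affine bundle `W^λ ⊆ T^*X`: the covectors `λ_x + β`, with `β` in the
span of the components of the generator at `x`. -/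
def lepageFiber (P : VariationalProblem T J X V) (x : X) : Set (TangentSpace J x →L[ℝ] ℝ) :=
  {a | ∃ β ∈ Submodule.span ℝ (range fun φ : V →L[ℝ] ℝ => φ ∘L P.gen x), a = P.form x + β}

/-- The point of `T^*X` over `x` with multiplier `σ`. -/
def lepagePoint (P : VariationalProblem T J X V) (x : X) (σ : V →L[ℝ] ℝ) :
    TangentSpace J x →L[ℝ] ℝ :=
  P.form x + σ ∘L P.gen x

/-- The canonical Lepage equivalent, with `W^λ` parametrized by `X × V^*` through `lepagePoint`:
its form is the pullback `λ + σ(θ)` of the tautological form `a ↦ a ∘ τ_*` of `T^*X`, and its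
differential system is zero. -/
def lepage (P : VariationalProblem T J X V) :
    VariationalProblem T (J.prod 𝓘(ℝ, V →L[ℝ] ℝ)) (X × (V →L[ℝ] ℝ)) V where
  proj y := P.proj y.1
  form y := P.lepagePoint y.1 y.2 ∘L mfderiv (J.prod 𝓘(ℝ, V →L[ℝ] ℝ)) J Prod.fst y
  gen := 0

end VariationalProblem

end Variational

/-! ### The Lie group -/

section LieGroup

variable {E : Type*} [NormedAddCommGroup E] [NormedSpace ℝ E]
  {G : Type*} [TopologicalSpace G] [ChartedSpace E G] [Group G]

/-- The bracket of the Lie algebra `T_1 G` of `G`, whose underlying vector space is `E`. -/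
def lieBr (G : Type*) [TopologicalSpace G] [ChartedSpace E G] [Group G] (x y : E) : E :=
  let x' : GroupLieAlgebra 𝓘(ℝ, E) G := x
  let y' : GroupLieAlgebra 𝓘(ℝ, E) G := y
  (⁅x', y'⁆ : GroupLieAlgebra 𝓘(ℝ, E) G)

/-- The adjoint action `Ad_g`, the derivative at `1` of `x ↦ g x g⁻¹`. -/
def Ad (g : G) : E →L[ℝ] E :=
  (mfderiv 𝓘(ℝ, E) 𝓘(ℝ, E) (fun x : G => g * x * g⁻¹) 1 :)

/-- The coadjoint action, `(Ad^♯_g φ)(ξ) = φ(Ad_{g⁻¹} ξ)`. -/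
def AdSharp (g : G) (φ : E →L[ℝ] ℝ) : E →L[ℝ] ℝ :=
  φ ∘L Ad g⁻¹

/-- `(ad^♯_κ φ)(ξ) = φ([ξ, κ])`. -/
def adSharp (G : Type*) [TopologicalSpace G] [ChartedSpace E G] [Group G] (κ : E)
    (φ : E →L[ℝ] ℝ) (ξ : E) : ℝ :=
  φ (lieBr G ξ κ)

/-- The left Maurer-Cartan form. -/
def maurerCartan (g : G) : TangentSpace 𝓘(ℝ, E) g →L[ℝ] E :=
  (mfderiv 𝓘(ℝ, E) 𝓘(ℝ, E) (fun x : G => g⁻¹ * x) g :)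

end LieGroup

/-! ### The nonstandard variational problem -/

/-- The data of the problem, for a Lie group `G` with Lie algebra (with underlying vector space)
`E`: a splitting `E = 𝔞 ⊕ 𝔟` (such as the one induced by a factorization `G = AB`), an invariant symmetric bilinear form `B`, and functionals
`μ ∈ 𝔟⁰`, `ν ∈ 𝔞⁰`. Neither nondegeneracy of `B` nor closedness of `𝔞`, `𝔟` under the bracket is
required. -/
structure Data (E : Type*) [NormedAddCommGroup E] [NormedSpace ℝ E] (G : Type*)
    [TopologicalSpace G] [ChartedSpace E G] [Group G] where
  𝔞 : Submodule ℝ E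
  𝔟 : Submodule ℝ E
  isCompl : IsCompl 𝔞 𝔟
  B : E →L[ℝ] E →L[ℝ] ℝ
  symm : ∀ x y, B x y = B y x
  invariant : ∀ ζ ξ, adSharp G ζ (B ζ) ξ = 0
  μ : E →L[ℝ] ℝ
  ν : E →L[ℝ] ℝ
  μ_mem : ∀ x ∈ 𝔟, μ x = 0
  ν_mem : ∀ x ∈ 𝔞, ν x = 0

namespace Data

variable {E : Type*} [NormedAddCommGroup E] [NormedSpace ℝ E]
  {G : Type*} [TopologicalSpace G] [ChartedSpace E G] [Group G]

/-- The velocity space `Λ = TG ⊕ 𝔞_G ⊕ 𝔟_G`, with `TG` left trivialized; its points are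
`(g, J, α, β)`. -/
abbrev Vel (D : Data E G) : Type _ := G × E × D.𝔞 × D.𝔟

abbrev velModel (D : Data E G) :=
  𝓘(ℝ, E).prod (𝓘(ℝ, E).prod (𝓘(ℝ, D.𝔞).prod 𝓘(ℝ, D.𝔟)))

/-- The model of `T × Λ`. -/
abbrev totalModel (D : Data E G) := 𝓘(ℝ, ℝ).prod D.velModel

variable {T : Opens ℝ}

/-- The form `dt` on `T × Λ`. -/
def dt (D : Data E G) : OneForm D.totalModel (T × D.Vel) ℝ := fun x =>
  (mfderiv D.totalModel 𝓘(ℝ, ℝ) (fun y : T × D.Vel => (y.1 : ℝ)) x :)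

/-- The left Maurer-Cartan form of `G`, pulled back to `T × Λ`. -/
def mc (D : Data E G) : OneForm D.totalModel (T × D.Vel) E := fun x =>
  maurerCartan x.2.1 ∘L mfderiv D.totalModel 𝓘(ℝ, E) (fun y : T × D.Vel => y.2.1) x

/-- `θ = λ - (J - Ad_{g⁻¹} α - β) dt`. -/
def θ (D : Data E G) : OneForm D.totalModel (T × D.Vel) E := fun x =>
  let g := x.2.1
  let J := x.2.2.1
  let α : E := x.2.2.2.1
  let β : E := x.2.2.2.2
  D.mc x - (D.dt x).smulRight (J - Ad g⁻¹ α - β)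

/-- `L_{μν} = (1/2) B(J, J) - μ(α) - ν(β)`. -/
def L (D : Data E G) (p : D.Vel) : ℝ :=
  let J := p.2.1
  let α : E := p.2.2.1
  let β : E := p.2.2.2
  1 / 2 * D.B J J - D.μ α - D.ν β

/-- The variational problem `(Λ, L_{μν} dt, ⟨θ⟩)`. -/
def problem (D : Data E G) (T : Opens ℝ) :
    VariationalProblem T D.totalModel (T × D.Vel) E where
  proj := Prod.fst
  form x := D.L x.2 • D.dt x
  gen := D.θ

variable [FiniteDimensional ℝ E]

/-- The projection of `𝔤^* = 𝔞⁰ ⊕ 𝔟⁰` onto `𝔟⁰`, which is precomposition with the projection of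
`𝔤 = 𝔞 ⊕ 𝔟` onto `𝔞`. -/
def projB0 (D : Data E G) (φ : E →L[ℝ] ℝ) : E →L[ℝ] ℝ :=
  φ ∘L D.𝔞.subtypeL ∘L LinearMap.toContinuousLinearMap (Submodule.projectionOnto D.𝔞 D.𝔟 D.isCompl)

/-- The projection of `𝔤^* = 𝔞⁰ ⊕ 𝔟⁰` onto `𝔞⁰`. -/
def projA0 (D : Data E G) (φ : E →L[ℝ] ℝ) : E →L[ℝ] ℝ :=
  φ ∘L D.𝔟.subtypeL ∘L
    LinearMap.toContinuousLinearMap (Submodule.projectionOnto D.𝔟 D.𝔞 D.isCompl.symm)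

/-- The solutions of the Euler-Lagrange equations: integral sections of the system generated by
`dJ^♭ - ad^♯_{β dt} J^♭`, `θ`, `π_{𝔟⁰}(Ad^♯_g J^♭) - μ` and `π_{𝔞⁰}(J^♭) - ν`. -/
def eulerLagrangeSolutions (D : Data E G) (T : Opens ℝ) : Set (T → T × D.Vel) :=
  {γ | (D.problem T).IsSection γ ∧ ∀ t,
    let g := (γ t).2.1
    let J := (γ t).2.2.1
    let β : E := (γ t).2.2.2.2
    (∀ ξ, vectorVelocity (fun s => D.B (γ s).2.2.1) t ξ - adSharp G β (D.B J) ξ = 0) ∧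
    pull D.θ γ t = 0 ∧
    D.projB0 (AdSharp g (D.B J)) - D.μ = 0 ∧
    D.projA0 (D.B J) - D.ν = 0}

/-- The integral sections of the system on `Λ̃ = T × Λ × 𝔤^*` generated by
`dσ + ad^♯_{λ + Ad_{g⁻¹} α dt} σ`, `J^♭ - σ`, `θ`, `π_{𝔟⁰}(Ad^♯_g σ) - μ` and `π_{𝔞⁰}(σ) - ν`. -/
def hamiltonSolutions (D : Data E G) (T : Opens ℝ) :
    Set (T → (T × D.Vel) × (E →L[ℝ] ℝ)) :=
  {γ | (D.problem T).lepage.IsSection γ ∧ ∀ t,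
    let g := (γ t).1.2.1
    let J := (γ t).1.2.2.1
    let α : E := (γ t).1.2.2.2.1
    let σ := (γ t).2
    (∀ ξ, vectorVelocity (fun s => (γ s).2) t ξ
      + adSharp G (pull D.mc (Prod.fst ∘ γ) t + Ad g⁻¹ α) σ ξ = 0) ∧
    D.B J - σ = 0 ∧
    pull D.θ (Prod.fst ∘ γ) t = 0 ∧
    D.projB0 (AdSharp g σ) - D.μ = 0 ∧
    D.projA0 σ - D.ν = 0}

end Data

end AKS

end

noncomputable section

open Set MeasureTheory TopologicalSpace
open scoped Manifold ContDiff

namespace AKS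

/-! ### Logarithmic derivatives, the Maurer–Cartan equation, and the bracket in a chart. -/

section LieGroupCalculus

open scoped Topology
open Filter VectorField

variable {E : Type*} [NormedAddCommGroup E] [NormedSpace ℝ E]
  {G : Type*} [TopologicalSpace G] [ChartedSpace E G] [Group G]
  {M : Type*} [NormedAddCommGroup M] [NormedSpace ℝ M]
  {N : Type*} [NormedAddCommGroup N] [NormedSpace ℝ N]

/-! The term `σ(θ)` is a Lagrange multiplier term. In `L dt + σ(θ)` the variables `J` and `σ` enter
without derivatives, and varying them gives `σ = J^♭` and `θ = 0`
(`constraints_of_lepage_extremal`). An extremal upstairs is therefore determined by its projection.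
If `σ` is frozen along an admissible variation, `σ(θ)` contributes nothing to first order, so
projections of extremals are extremals (`fst_comp_mem_extremals`).

The delicate direction is contravariance, since a constrained problem may have too few admissible
variations. Here `θ = 0` can be solved for `J`, so every compactly supported variation of `g`, `α`,
`β` extends to a family on which `θ` vanishes identically. Let `u` and `w` be the logarithmic
derivatives of `g` in the parameter and in time. The Maurer–Cartan equation and the derivative of
`Ad_{g⁻¹}` give `δJ = ∂ₜu - [u, w + Ad_{g⁻¹} α] + Ad_{g⁻¹} δα + δβ` (`hasDerivAt_thetaFn`).
Inserting this in `δL = J^♭(δJ) - μ(δα) - ν(δβ)` and integrating by parts yields the Hamiltonian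
system for `σ = J^♭` (`first_variation`). Conversely, that system turns `δ(L + σ(θ))` into the total
time derivative of `σ(u)`, whose integral vanishes (`hamiltonSolutions_subset`).

This closes the circle: extremal downstairs, Hamiltonian solution, extremal upstairs, projection. On
`θ = 0` the form `λ + Ad_{g⁻¹} α dt` pulls back to `(J - β) dt`, and `ad^♯_J J^♭ = 0` converts the
Hamiltonian system into the Euler–Lagrange equations. -/

theorem two_le_infty : (2 : ℕ∞ω) ≤ ∞ := by
  exact ENat.LEInfty.out

/-- The preferred chart of `G` at the identity. -/
abbrev chartOne (E : Type*) [NormedAddCommGroup E] [NormedSpace ℝ E] (G : Type*)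
    [TopologicalSpace G] [ChartedSpace E G] [Group G] : PartialEquiv G E :=
  extChartAt 𝓘(ℝ, E) (1 : G)

/-- The coordinates of the identity. -/
abbrev origin (E : Type*) [NormedAddCommGroup E] [NormedSpace ℝ E] (G : Type*)
    [TopologicalSpace G] [ChartedSpace E G] [Group G] : E :=
  chartOne E G 1

/-- The logarithmic derivative `F⁻¹ dF`, computed in the chart at the identity. -/
def logDeriv (E : Type*) [NormedAddCommGroup E] [NormedSpace ℝ E] {G : Type*}
    [TopologicalSpace G] [ChartedSpace E G] [Group G] (F : M → G) (p : M) : M →L[ℝ] E :=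
  fderiv ℝ (fun q => chartOne E G ((F p)⁻¹ * F q)) p

/-- The Maurer-Cartan form in the chart at the identity. -/
def mcCoord (E : Type*) [NormedAddCommGroup E] [NormedSpace ℝ E] (G : Type*)
    [TopologicalSpace G] [ChartedSpace E G] [Group G] (x : E) : E →L[ℝ] E :=
  logDeriv E (chartOne E G).symm x

theorem logDeriv_const_mul (g : G) (F : M → G) (p : M) :
    logDeriv E (fun q => g * F q) p = logDeriv E F p := by
  simp [logDeriv, mul_assoc]

theorem logDeriv_congr {F F' : M → G} {p : M} (h : F =ᶠ[𝓝 p] F') :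
    logDeriv E F p = logDeriv E F' p := by
  unfold logDeriv
  refine EventuallyEq.fderiv_eq ?_
  filter_upwards [h] with q hq
  rw [hq, h.eq_of_nhds]

theorem origin_mem : origin E G ∈ (chartOne E G).target := mem_extChartAt_target 1

theorem isOpen_chartOne_target : IsOpen (chartOne E G).target := isOpen_extChartAt_target 1

theorem isOpen_chartOne_source : IsOpen (chartOne E G).source := isOpen_extChartAt_source 1

theorem chartOne_symm_origin : (chartOne E G).symm (origin E G) = 1 := extChartAt_to_inv 1

theorem mcCoord_origin : mcCoord E G (origin E G) = ContinuousLinearMap.id ℝ E := by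
  unfold mcCoord logDeriv
  rw [← fderiv_id (𝕜 := ℝ) (x := origin E G)]
  refine EventuallyEq.fderiv_eq ?_
  filter_upwards [isOpen_chartOne_target.mem_nhds (origin_mem (E := E) (G := G))] with y hy
  rw [chartOne_symm_origin]
  simpa using (chartOne E G).right_inv hy

variable (G) in
/-- The bracket of the Lie algebra as a continuous bilinear map in coordinates. -/
def brCLM : E →L[ℝ] E →L[ℝ] E :=
  (fderiv ℝ (mcCoord E G) (origin E G)).flip - fderiv ℝ (mcCoord E G) (origin E G)

theorem brCLM_apply (v w : E) : brCLM G v w =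
    fderiv ℝ (mcCoord E G) (origin E G) w v - fderiv ℝ (mcCoord E G) (origin E G) v w := rfl

variable [LieGroup 𝓘(ℝ, E) ∞ G]

theorem contMDiffOn_chartOne :
    ContMDiffOn 𝓘(ℝ, E) 𝓘(ℝ, E) ∞ (chartOne E G) (chartOne E G).source := by
  rw [extChartAt_source]
  exact contMDiffOn_extChartAt

theorem contMDiffAt_chartOne {g : G} (hg : g ∈ (chartOne E G).source) :
    ContMDiffAt 𝓘(ℝ, E) 𝓘(ℝ, E) ∞ (chartOne E G) g :=
  contMDiffOn_chartOne.contMDiffAt (isOpen_chartOne_source.mem_nhds hg)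

theorem contMDiffAt_chartOne_symm {x : E} (hx : x ∈ (chartOne E G).target) :
    ContMDiffAt 𝓘(ℝ, E) 𝓘(ℝ, E) ∞ (chartOne E G).symm x :=
  (contMDiffOn_extChartAt_symm (1 : G)).contMDiffAt (isOpen_chartOne_target.mem_nhds hx)

theorem contDiffAt_chart_inv_mul {F : M → G} {F' : N → G} {p : M} {q : N}
    (hF : ContMDiffAt 𝓘(ℝ, M) 𝓘(ℝ, E) ∞ F p) (hF' : ContMDiffAt 𝓘(ℝ, N) 𝓘(ℝ, E) ∞ F' q)
    (h : (F p)⁻¹ * F' q ∈ (chartOne E G).source) :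
    ContDiffAt ℝ ∞ (fun z : M × N => chartOne E G ((F z.1)⁻¹ * F' z.2)) (p, q) := by
  rw [← contMDiffAt_iff_contDiffAt]
  have h1 : ContMDiffAt 𝓘(ℝ, M × N) 𝓘(ℝ, E) ∞ (fun z : M × N => (F z.1)⁻¹ * F' z.2) (p, q) :=
    (ContMDiffAt.comp (p, q) hF contDiffAt_fst.contMDiffAt).inv.mul
      (ContMDiffAt.comp (p, q) hF' contDiffAt_snd.contMDiffAt)
  exact ContMDiffAt.comp (p, q) (contMDiffAt_chartOne h) h1

/-- The point `p` is both the base point of the derivative and a parameter through `(F p)⁻¹`. Joint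
smoothness in the two roles, from `contDiffAt_chart_inv_mul`, makes this a smooth parametrized
derivative. -/
theorem contDiffAt_logDeriv {F : M → G} {p : M} (hF : ContMDiffAt 𝓘(ℝ, M) 𝓘(ℝ, E) ∞ F p) :
    ContDiffAt ℝ ∞ (logDeriv E F) p := by
  unfold logDeriv
  refine ContDiffAt.fderiv (f := fun p q => chartOne E G ((F p)⁻¹ * F q)) (g := id) (n := ∞)
    ?_ contDiffAt_id (by simp)
  exact contDiffAt_chart_inv_mul hF hF (by simp)

theorem contDiffAt_mcCoord {x : E} (hx : x ∈ (chartOne E G).target) :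
    ContDiffAt ℝ ∞ (mcCoord E G) x :=
  contDiffAt_logDeriv (contMDiffAt_chartOne_symm hx)

/-- The chain rule for the logarithmic derivative. -/
theorem logDeriv_comp {F : N → G} {k : M → N} {p : M}
    (hF : ContMDiffAt 𝓘(ℝ, N) 𝓘(ℝ, E) ∞ F (k p)) (hk : DifferentiableAt ℝ k p) :
    logDeriv E (F ∘ k) p = logDeriv E F (k p) ∘L fderiv ℝ k p := by
  unfold logDeriv
  have h := contDiffAt_chart_inv_mul (p := k p) hF hF (by simp)
  have h' : DifferentiableAt ℝ (fun q => chartOne E G ((F (k p))⁻¹ * F q)) (k p) :=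
    (h.comp (k p) (contDiffAt_const.prodMk contDiffAt_id)).differentiableAt (by simp)
  exact fderiv_comp p h' hk

theorem contDiffAt_chart {F : M → G} {p : M} (hF : ContMDiffAt 𝓘(ℝ, M) 𝓘(ℝ, E) ∞ F p)
    (h : F p ∈ (chartOne E G).source) : ContDiffAt ℝ ∞ (fun q => chartOne E G (F q)) p := by
  rw [← contMDiffAt_iff_contDiffAt]
  exact ContMDiffAt.comp p (contMDiffAt_chartOne h) hF

theorem logDeriv_eq_mcCoord {F : M → G} {p : M} (hF : ContMDiffAt 𝓘(ℝ, M) 𝓘(ℝ, E) ∞ F p)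
    (h : F p ∈ (chartOne E G).source) :
    logDeriv E F p = mcCoord E G (chartOne E G (F p)) ∘L
      fderiv ℝ (fun q => chartOne E G (F q)) p := by
  have h1 : F =ᶠ[𝓝 p] (chartOne E G).symm ∘ (fun q => chartOne E G (F q)) := by
    filter_upwards [hF.continuousAt.preimage_mem_nhds (isOpen_chartOne_source.mem_nhds h)] with q hq
    exact ((chartOne E G).left_inv hq).symm
  rw [logDeriv_congr h1, logDeriv_comp, mcCoord]
  · exact contMDiffAt_chartOne_symm ((chartOne E G).map_source h)
  · exact (contDiffAt_chart hF h).differentiableAt (by simp)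

/-- The Maurer-Cartan equation. -/
theorem maurerCartan_equation {F : M → G} {p : M} {U : Set M} (hU : IsOpen U) (hp : p ∈ U)
    (hF : ContMDiffOn 𝓘(ℝ, M) 𝓘(ℝ, E) ∞ F U) (a b : M) :
    fderiv ℝ (logDeriv E F) p a b - fderiv ℝ (logDeriv E F) p b a =
      -brCLM G (logDeriv E F p a) (logDeriv E F p b) := by
  have hFat : ∀ q ∈ U, ContMDiffAt 𝓘(ℝ, M) 𝓘(ℝ, E) ∞ F q :=
    fun q hq => hF.contMDiffAt (hU.mem_nhds hq)
  -- Left translation does not change the logarithmic derivative, so one may assume that `F` sends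
  -- `p` to `1`, where the coordinate Maurer–Cartan form is the identity.
  set F₁ : M → G := fun q => (F p)⁻¹ * F q with hF₁
  have e : logDeriv E F = logDeriv E F₁ := by
    ext1 q; exact (logDeriv_const_mul _ _ _).symm
  have hF₁at : ∀ q ∈ U, ContMDiffAt 𝓘(ℝ, M) 𝓘(ℝ, E) ∞ F₁ q :=
    fun q hq => contMDiffAt_const.mul (hFat q hq)
  have hp1 : F₁ p = 1 := by simp [hF₁]
  set k : M → E := fun q => chartOne E G (F₁ q) with hk
  have hps : F₁ p ∈ (chartOne E G).source := by rw [hp1]; exact mem_extChartAt_source 1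
  have hev : ∀ᶠ q in 𝓝 p, q ∈ U ∧ F₁ q ∈ (chartOne E G).source :=
    Filter.Eventually.and (hU.mem_nhds hp)
      ((hF₁at p hp).continuousAt.preimage_mem_nhds (isOpen_chartOne_source.mem_nhds hps))
  have hloc : logDeriv E F₁ =ᶠ[𝓝 p] fun q => mcCoord E G (k q) ∘L fderiv ℝ k q := by
    filter_upwards [hev] with q hq
    exact logDeriv_eq_mcCoord (hF₁at q hq.1) hq.2
  have hkp : k p = origin E G := by simp only [hk, hp1]
  have hkd : ContDiffAt ℝ ∞ k p := contDiffAt_chart (hF₁at p hp) hps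
  have hA : HasFDerivAt (mcCoord E G) (fderiv ℝ (mcCoord E G) (origin E G)) (k p) := by
    rw [hkp]
    exact ((contDiffAt_mcCoord origin_mem).differentiableAt (by simp)).hasFDerivAt
  have hA' := hA.comp p (hkd.differentiableAt (by simp)).hasFDerivAt
  have hk' : HasFDerivAt (fderiv ℝ k) (fderiv ℝ (fderiv ℝ k) p) p :=
    ((hkd.fderiv_right (m := 1) two_le_infty).differentiableAt (by simp)).hasFDerivAt
  have hval : logDeriv E F₁ p = fderiv ℝ k p := by
    rw [hloc.eq_of_nhds, hkp, mcCoord_origin]; ext; simp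
  have hd := (hA'.clm_comp hk').congr_of_eventuallyEq hloc
  -- Antisymmetrizing kills the second derivative of `k`; only the derivative of `mcCoord` survives,
  -- and it is the one that defines `brCLM`.
  have hsymm : fderiv ℝ (fderiv ℝ k) p a b = fderiv ℝ (fderiv ℝ k) p b a :=
    (hkd.isSymmSndFDerivAt (by simpa using two_le_infty)) a b
  rw [e, hd.fderiv, hval, brCLM_apply]
  simp [hkp, mcCoord_origin, hsymm]

theorem hasMFDerivAt_chartOne :
    HasMFDerivAt 𝓘(ℝ, E) 𝓘(ℝ, E) (chartOne E G) 1 (ContinuousLinearMap.id ℝ E) := by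
  have := (mdifferentiableAt_extChartAt (I := 𝓘(ℝ, E))
    (mem_chart_source E (1 : G))).hasMFDerivAt
  rwa [mfderiv_extChartAt_self] at this

/-- The logarithmic derivative is the pullback of the Maurer-Cartan form. -/
theorem logDeriv_eq_maurerCartan {F : M → G} {p : M}
    (hF : MDifferentiableAt 𝓘(ℝ, M) 𝓘(ℝ, E) F p) (v : M) :
    logDeriv E F p v = maurerCartan (F p) (mfderiv 𝓘(ℝ, M) 𝓘(ℝ, E) F p v) := by
  have h2 : HasMFDerivAt 𝓘(ℝ, E) 𝓘(ℝ, E) (fun x : G => (F p)⁻¹ * x) (F p)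
      (mfderiv 𝓘(ℝ, E) 𝓘(ℝ, E) (fun x : G => (F p)⁻¹ * x) (F p)) :=
    ((contMDiff_mul_left (I := 𝓘(ℝ, E)) (n := ∞)).mdifferentiableAt (by simp)).hasMFDerivAt
  have h3 : HasMFDerivAt 𝓘(ℝ, E) 𝓘(ℝ, E) (chartOne E G) ((F p)⁻¹ * F p)
      (ContinuousLinearMap.id ℝ E) := by
    rw [inv_mul_cancel]
    exact hasMFDerivAt_chartOne
  let A₁ : M →L[ℝ] E := mfderiv 𝓘(ℝ, M) 𝓘(ℝ, E) F p
  let A₂ : E →L[ℝ] E := maurerCartan (F p)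
  have h : HasFDerivAt (fun q => chartOne E G ((F p)⁻¹ * F q))
      (((ContinuousLinearMap.id ℝ E).comp A₂).comp A₁) p :=
    hasMFDerivAt_iff_hasFDerivAt.1 ((h3.comp (F p) h2).comp p hF.hasMFDerivAt)
  exact DFunLike.congr_fun h.fderiv v

theorem maurerCartan_mulInvariantVectorField (v : GroupLieAlgebra 𝓘(ℝ, E) G) (g : G) :
    maurerCartan g (mulInvariantVectorField v g) = v := by
  have h1 : HasMFDerivAt 𝓘(ℝ, E) 𝓘(ℝ, E) (fun x : G => g * x) 1
      (mfderiv 𝓘(ℝ, E) 𝓘(ℝ, E) (fun x : G => g * x) 1) :=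
    ((contMDiff_mul_left (I := 𝓘(ℝ, E)) (n := ∞)).mdifferentiableAt (by simp)).hasMFDerivAt
  have h2 : HasMFDerivAt 𝓘(ℝ, E) 𝓘(ℝ, E) (fun x : G => g⁻¹ * x) (g * 1)
      (mfderiv 𝓘(ℝ, E) 𝓘(ℝ, E) (fun x : G => g⁻¹ * x) (g * 1)) :=
    ((contMDiff_mul_left (I := 𝓘(ℝ, E)) (n := ∞)).mdifferentiableAt (by simp)).hasMFDerivAt
  have h := h2.comp 1 h1
  have e : (fun x : G => g⁻¹ * x) ∘ (fun x : G => g * x) = id := by ext x; simp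
  rw [e] at h
  have h' := hasMFDerivAt_unique h (hasMFDerivAt_id 1)
  have h'' := DFunLike.congr_fun h' v
  unfold maurerCartan mulInvariantVectorField
  -- The chain rule produces the derivative at `g * 1`, whose tangent space is only propositionally
  -- that at `g`; generalizing the point allows substitution.
  have e2 : ∀ g' : G, g' = g → ∀ w : E,
      (mfderiv 𝓘(ℝ, E) 𝓘(ℝ, E) (fun x : G => g⁻¹ * x) g' : E →L[ℝ] E) w
        = (mfderiv 𝓘(ℝ, E) 𝓘(ℝ, E) (fun x : G => g⁻¹ * x) g : E →L[ℝ] E) w := by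
    rintro _ rfl w; rfl
  exact (e2 (g * 1) (mul_one g) _).symm.trans h''

/-- The left invariant vector field through `v`, in the chart at the identity. -/
def invariantFieldCoord (G : Type*) [TopologicalSpace G] [ChartedSpace E G] [Group G] (v : E) :
    E → E :=
  mpullbackWithin 𝓘(ℝ, E) 𝓘(ℝ, E) (chartOne E G).symm
    (mulInvariantVectorField (v : GroupLieAlgebra 𝓘(ℝ, E) G)) (range 𝓘(ℝ, E))

/-- The Maurer–Cartan form is constant on left invariant fields. Near the origin this exhibits the
field as `(mcCoord x)⁻¹ v`, a form that can be differentiated. -/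
theorem mcCoord_invariantFieldCoord (v : E) {x : E} (hx : x ∈ (chartOne E G).target) :
    mcCoord E G x (invariantFieldCoord G v x) = v := by
  have : IsManifold 𝓘(ℝ, E) 1 G := IsManifold.of_le (n := ∞) (by simp)
  unfold mcCoord
  rw [logDeriv_eq_maurerCartan ((contMDiffAt_chartOne_symm hx).mdifferentiableAt (by simp))]
  have hinv := isInvertible_mfderivWithin_extChartAt_symm (I := 𝓘(ℝ, E)) hx
  have h1 : mfderiv 𝓘(ℝ, E) 𝓘(ℝ, E) (chartOne E G).symm x (invariantFieldCoord (E := E) G v x) =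
      mulInvariantVectorField (v : GroupLieAlgebra 𝓘(ℝ, E) G) ((chartOne E G).symm x) := by
    have h2 := DFunLike.congr_fun hinv.self_comp_inverse
      (mulInvariantVectorField (v : GroupLieAlgebra 𝓘(ℝ, E) G) ((chartOne E G).symm x))
    rw [← mfderivWithin_univ, ← range_id]
    exact h2
  rw [h1]
  exact maurerCartan_mulInvariantVectorField _ _

/-- The left translate of `F` by the point with coordinates `y`. -/
def leftFamily (E : Type*) [NormedAddCommGroup E] [NormedSpace ℝ E] {G : Type*}
    [TopologicalSpace G] [ChartedSpace E G] [Group G] (F : M → G) (z : E × M) : G :=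
  (chartOne E G).symm z.1 * F z.2

theorem contMDiffOn_leftFamily {F : M → G} {U : Set M}
    (hF : ContMDiffOn 𝓘(ℝ, M) 𝓘(ℝ, E) ∞ F U) :
    ContMDiffOn 𝓘(ℝ, E × M) 𝓘(ℝ, E) ∞ (leftFamily E F) ((chartOne E G).target ×ˢ U) := by
  refine ContMDiffOn.mul (f := fun z : E × M => (chartOne E G).symm z.1) (g := fun z => F z.2) ?_ ?_
  · exact (contMDiffOn_extChartAt_symm (1 : G)).comp contDiff_fst.contMDiff.contMDiffOn
      (fun z hz => hz.1)
  · exact hF.comp contDiff_snd.contMDiff.contMDiffOn (fun z hz => hz.2)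

theorem contMDiffAt_leftFamily {F : M → G} {p : M} {U : Set M} (hU : IsOpen U) (hp : p ∈ U)
    (hF : ContMDiffOn 𝓘(ℝ, M) 𝓘(ℝ, E) ∞ F U) {y : E} (hy : y ∈ (chartOne E G).target) :
    ContMDiffAt 𝓘(ℝ, E × M) 𝓘(ℝ, E) ∞ (leftFamily E F) (y, p) :=
  (contMDiffOn_leftFamily hF).contMDiffAt
    (((isOpen_chartOne_target (E := E) (G := G)).prod hU).mem_nhds ⟨hy, hp⟩)

theorem fst_slice_hasFDerivAt (p : M) (y : E) :
    HasFDerivAt (fun x : E => (x, p)) (ContinuousLinearMap.inl ℝ E M) y :=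
  (hasFDerivAt_id y).prodMk (hasFDerivAt_const p y)

/-- For fixed `y` the family is a left translate of `F`, so the value does not depend on `y`. -/
theorem logDeriv_leftFamily_inr {F : M → G} {p : M} {U : Set M} (hU : IsOpen U) (hp : p ∈ U)
    (hF : ContMDiffOn 𝓘(ℝ, M) 𝓘(ℝ, E) ∞ F U) {y : E} (hy : y ∈ (chartOne E G).target) (b : M) :
    logDeriv E (leftFamily E F) (y, p) (0, b) = logDeriv E F p b := by
  have hL := contMDiffAt_leftFamily hU hp hF hy
  have hk : HasFDerivAt (fun q : M => (y, q)) (ContinuousLinearMap.inr ℝ E M) p :=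
    (hasFDerivAt_const y p).prodMk (hasFDerivAt_id p)
  have h := logDeriv_comp (F := leftFamily E F) (k := fun q : M => (y, q)) hL hk.differentiableAt
  have h' : logDeriv E (leftFamily E F ∘ fun q : M => (y, q)) p = logDeriv E F p :=
    logDeriv_const_mul _ F p
  rw [← h', h, hk.fderiv]
  simp

/-- After translation back to `1` the curve in the first slot is `y ↦ F(p)⁻¹ φ⁻¹(y) F(p)`, with `φ`
the chart at `1`. This is a conjugation, and both `φ` and `φ⁻¹` have derivative the identity there.
-/
theorem logDeriv_leftFamily_inl {F : M → G} {p : M} {U : Set M} (hU : IsOpen U) (hp : p ∈ U)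
    (hF : ContMDiffOn 𝓘(ℝ, M) 𝓘(ℝ, E) ∞ F U) (ξ : E) :
    logDeriv E (leftFamily E F) (origin E G, p) (ξ, 0) = Ad (F p)⁻¹ ξ := by
  have hL := contMDiffAt_leftFamily hU hp hF origin_mem
  have hk := fst_slice_hasFDerivAt (E := E) p (origin E G)
  have h := logDeriv_comp (F := leftFamily E F) (k := fun q : E => (q, p)) hL hk.differentiableAt
  rw [hk.fderiv] at h
  have h1 : logDeriv E (leftFamily E F ∘ fun q : E => (q, p)) (origin E G) ξ = Ad (F p)⁻¹ ξ := by
    have hs : HasMFDerivAt 𝓘(ℝ, E) 𝓘(ℝ, E) (chartOne E G).symm (origin E G)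
        (ContinuousLinearMap.id ℝ E) := by
      have : IsManifold 𝓘(ℝ, E) 1 G := IsManifold.of_le (n := ∞) (by simp)
      have h2 := ((contMDiffAt_chartOne_symm (E := E) (G := G) origin_mem).mdifferentiableAt
        (by simp)).hasMFDerivAt
      have h3 := mfderivWithin_range_extChartAt_symm (I := 𝓘(ℝ, E)) (x := (1 : G))
      simp only [modelWithCornersSelf_coe, range_id, mfderivWithin_univ] at h3
      rwa [h3] at h2
    have hconj : HasMFDerivAt 𝓘(ℝ, E) 𝓘(ℝ, E) (fun x : G => (F p)⁻¹ * x * (F p)⁻¹⁻¹)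
        ((chartOne E G).symm (origin E G)) (Ad (F p)⁻¹ : E →L[ℝ] E) := by
      rw [chartOne_symm_origin]
      have h2 : ContMDiff 𝓘(ℝ, E) 𝓘(ℝ, E) ∞ (fun x : G => (F p)⁻¹ * x * (F p)⁻¹⁻¹) :=
        (contMDiff_const.mul contMDiff_id).mul contMDiff_const
      exact (h2.mdifferentiableAt (by simp)).hasMFDerivAt
    have hφ : HasMFDerivAt 𝓘(ℝ, E) 𝓘(ℝ, E) (chartOne E G)
        ((F p)⁻¹ * (chartOne E G).symm (origin E G) * (F p)⁻¹⁻¹) (ContinuousLinearMap.id ℝ E) := by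
      rw [chartOne_symm_origin, mul_one, mul_inv_cancel]
      exact hasMFDerivAt_chartOne
    have h2 : HasFDerivAt
        (fun q => chartOne E G ((F p)⁻¹ * (chartOne E G).symm q * (F p)⁻¹⁻¹))
        (((ContinuousLinearMap.id ℝ E).comp (Ad (F p)⁻¹ : E →L[ℝ] E)).comp
          (ContinuousLinearMap.id ℝ E)) (origin E G) :=
      hasMFDerivAt_iff_hasFDerivAt.1
        (HasMFDerivAt.comp (g := chartOne E G ∘ fun x : G => (F p)⁻¹ * x * (F p)⁻¹⁻¹)
          (origin E G) (HasMFDerivAt.comp _ hφ hconj) hs)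
    have h3 : logDeriv E (leftFamily E F ∘ fun q : E => (q, p)) (origin E G) =
        fderiv ℝ (fun q => chartOne E G ((F p)⁻¹ * (chartOne E G).symm q * (F p)⁻¹⁻¹))
          (origin E G) := by
      simp only [logDeriv, leftFamily, Function.comp_apply, chartOne_symm_origin, one_mul, inv_inv,
        mul_assoc]
    rw [h3, h2.fderiv]
    simp
  rw [← h1, h]
  simp

/-- Smoothness of `Ad` is read off from the logarithmic derivative of `leftFamily`, of which it is a
component. -/
theorem contDiffAt_Ad_inv {F : M → G} {p : M} {U : Set M} (hU : IsOpen U) (hp : p ∈ U)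
    (hF : ContMDiffOn 𝓘(ℝ, M) 𝓘(ℝ, E) ∞ F U) :
    ContDiffAt ℝ ∞ (fun q => (Ad (F q)⁻¹ : E →L[ℝ] E)) p := by
  have hL := contMDiffAt_leftFamily hU hp hF origin_mem
  have h1 : ContDiffAt ℝ ∞ (fun q : M => logDeriv E (leftFamily E F) (origin E G, q)) p :=
    ContDiffAt.comp p (contDiffAt_logDeriv hL) (contDiffAt_const.prodMk contDiffAt_id)
  refine (h1.clm_comp (contDiffAt_const (c := ContinuousLinearMap.inl ℝ E M))).congr_of_eventuallyEq
    ?_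
  filter_upwards [hU.mem_nhds hp] with q hq
  ext ξ
  simp [logDeriv_leftFamily_inl hU hq hF]

/-- The derivative of `p ↦ Ad_{F(p)⁻¹} ξ`. -/
theorem fderiv_Ad_inv {F : M → G} {p : M} {U : Set M} (hU : IsOpen U) (hp : p ∈ U)
    (hF : ContMDiffOn 𝓘(ℝ, M) 𝓘(ℝ, E) ∞ F U) (b : M) (ξ : E) :
    fderiv ℝ (fun q => (Ad (F q)⁻¹ : E →L[ℝ] E)) p b ξ =
      -brCLM G (logDeriv E F p b) (Ad (F p)⁻¹ ξ) := by
  have hmem : (origin E G, p) ∈ (chartOne E G).target ×ˢ U := ⟨origin_mem, hp⟩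
  have hO := (isOpen_chartOne_target (E := E) (G := G)).prod hU
  have hLon := contMDiffOn_leftFamily hF
  have hmc := maurerCartan_equation hO hmem hLon (0, b) (ξ, 0)
  -- Of the two derivatives in the Maurer–Cartan equation, one differentiates the `b` component in
  -- `y`, on which it does not depend; the other is the derivative of `Ad (F q)⁻¹ ξ`.
  rw [logDeriv_leftFamily_inl hU hp hF, logDeriv_leftFamily_inr hU hp hF origin_mem] at hmc
  have hd := ((contDiffAt_logDeriv (hLon.contMDiffAt (hO.mem_nhds hmem))).differentiableAt
    (by simp)).hasFDerivAt
  have h1 : fderiv ℝ (logDeriv E (leftFamily E F)) (origin E G, p) (ξ, 0) (0, b) = 0 := by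
    have h2 := (hd.comp (origin E G) (fst_slice_hasFDerivAt (E := E) p (origin E G))).clm_apply
      (hasFDerivAt_const ((0, b) : E × M) (origin E G))
    have h3 : HasFDerivAt (fun y : E => logDeriv E (leftFamily E F) (y, p) (0, b))
        (0 : E →L[ℝ] E) (origin E G) := by
      refine (hasFDerivAt_const (logDeriv E F p b) (origin E G)).congr_of_eventuallyEq ?_
      filter_upwards [isOpen_chartOne_target.mem_nhds (origin_mem (E := E) (G := G))] with y hy
      exact logDeriv_leftFamily_inr hU hp hF hy b
    simpa using DFunLike.congr_fun (h2.unique h3) ξ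
  have hin : HasFDerivAt (fun q : M => (origin E G, q)) (ContinuousLinearMap.inr ℝ E M) p :=
    (hasFDerivAt_const _ p).prodMk (hasFDerivAt_id p)
  have h4 := (hd.comp p hin).clm_apply (hasFDerivAt_const ((ξ, 0) : E × M) p)
  have h5 : (fun q => Ad (F q)⁻¹ ξ) =ᶠ[𝓝 p]
      fun q => logDeriv E (leftFamily E F) (origin E G, q) (ξ, 0) := by
    filter_upwards [hU.mem_nhds hp] with q hq
    exact (logDeriv_leftFamily_inl hU hq hF ξ).symm
  have h6 := (((contDiffAt_Ad_inv hU hp hF).differentiableAt (by simp)).hasFDerivAt).clm_apply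
    (hasFDerivAt_const ξ p)
  have h7 := DFunLike.congr_fun (h6.unique (h4.congr_of_eventuallyEq h5)) b
  simp only [add_apply, ContinuousLinearMap.comp_apply,
    zero_apply, map_zero, zero_add, ContinuousLinearMap.flip_apply,
    ContinuousLinearMap.inr_apply] at h7
  rw [h1, sub_zero] at hmc
  exact h7.trans hmc

variable [CompleteSpace E]

/-- The field is `(mcCoord x)⁻¹ v` near the origin, and inversion of operators has derivative `-1`
at the identity. -/
theorem hasFDerivAt_invariantFieldCoord (v : E) :
    HasFDerivAt (invariantFieldCoord G v)
      (-(fderiv ℝ (mcCoord E G) (origin E G)).flip v) (origin E G) := by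
  have hA : HasFDerivAt (mcCoord E G) (fderiv ℝ (mcCoord E G) (origin E G)) (origin E G) :=
    ((contDiffAt_mcCoord origin_mem).differentiableAt (by simp)).hasFDerivAt
  have hone : mcCoord E G (origin E G) = ((1 : (E →L[ℝ] E)ˣ) : E →L[ℝ] E) := mcCoord_origin
  have hinv := hasFDerivAt_ringInverse (𝕜 := ℝ) (1 : (E →L[ℝ] E)ˣ)
  rw [← hone] at hinv
  have hcomp := (hinv.comp _ hA).clm_apply (hasFDerivAt_const v (origin E G))
  have hev : invariantFieldCoord G v =ᶠ[𝓝 (origin E G)]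
      fun x => Ring.inverse (mcCoord E G x) v := by
    have hunit : ∀ᶠ x in 𝓝 (origin E G), IsUnit (mcCoord E G x) :=
      hA.continuousAt.eventually (by rw [hone]; exact Units.nhds 1)
    filter_upwards [hunit, isOpen_chartOne_target.mem_nhds (origin_mem (E := E) (G := G))]
      with x hx hxt
    have h1 := mcCoord_invariantFieldCoord (G := G) v hxt
    have h2 : Ring.inverse (mcCoord E G x) (mcCoord E G x (invariantFieldCoord G v x)) =
        invariantFieldCoord G v x :=
      DFunLike.congr_fun (Ring.inverse_mul_cancel _ hx) (invariantFieldCoord G v x)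
    rw [← h2, h1]
  refine (hcomp.congr_of_eventuallyEq hev).congr_fderiv ?_
  ext w
  simp

/-- The bracket of left invariant fields is `DX_w(v) - DX_v(w)` in the chart, and each `DX` is minus
the derivative of `mcCoord`. -/
theorem lieBr_eq_brCLM (v w : E) : lieBr G v w = brCLM G v w := by
  have e : ∀ u : E, invariantFieldCoord G u (origin E G) = u := fun u => by
    simpa [mcCoord_origin] using mcCoord_invariantFieldCoord (G := G) u origin_mem
  have h : lieBr G v w = lieBracketWithin ℝ (invariantFieldCoord G v) (invariantFieldCoord G w)
      univ (origin E G) := by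
    have h1 : lieBr G v w = mlieBracketWithin 𝓘(ℝ, E)
      (mulInvariantVectorField (v : GroupLieAlgebra 𝓘(ℝ, E) G))
      (mulInvariantVectorField (w : GroupLieAlgebra 𝓘(ℝ, E) G)) univ (1 : G) := rfl
    have : IsManifold 𝓘(ℝ, E) 1 G := IsManifold.of_le (n := ∞) (by simp)
    have h2 : ∀ A : E →L[ℝ] E, A = ContinuousLinearMap.id ℝ E →
        A.inverse = ContinuousLinearMap.id ℝ E := by
      rintro _ rfl; exact ContinuousLinearMap.inverse_id
    rw [h1, mlieBracketWithin_apply]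
    refine (DFunLike.congr_fun (h2 _ mfderiv_extChartAt_self) _).trans ?_
    simp only [invariantFieldCoord, preimage_univ, modelWithCornersSelf_coe, range_id, inter_univ]
    rfl
  rw [h, lieBracketWithin_univ, lieBracket_eq, brCLM_apply]
  simp only [(hasFDerivAt_invariantFieldCoord (G := G) _).fderiv, e]
  simp
  abel

end LieGroupCalculus

/-! ### Differentiation under the integral, integration by parts, and the fundamental lemma. -/

section Calculus

open scoped Topology
open Filter

variable {V : Type*} [NormedAddCommGroup V] [NormedSpace ℝ V]
  {W : Type*} [NormedAddCommGroup W] [NormedSpace ℝ W]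

theorem hasDerivAt_slice_fst {f : ℝ × ℝ → V} {s x : ℝ} (hf : DifferentiableAt ℝ f (s, x)) :
    HasDerivAt (fun s => f (s, x)) (fderiv ℝ f (s, x) (1, 0)) s :=
  hf.hasFDerivAt.comp_hasDerivAt s ((hasDerivAt_id s).prodMk (hasDerivAt_const s x))

theorem hasDerivAt_slice_snd {f : ℝ × ℝ → V} {s x : ℝ} (hf : DifferentiableAt ℝ f (s, x)) :
    HasDerivAt (fun x => f (s, x)) (fderiv ℝ f (s, x) (0, 1)) x :=
  hf.hasFDerivAt.comp_hasDerivAt x ((hasDerivAt_const x s).prodMk (hasDerivAt_id x))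

theorem fderiv_coe_mem {K : Submodule ℝ V} {f : W → K} {p : W} (hf : DifferentiableAt ℝ f p)
    (v : W) : fderiv ℝ (fun q => (f q : V)) p v ∈ K := by
  have h : HasFDerivAt (fun q => (f q : V)) (K.subtypeL ∘L fderiv ℝ f p) p :=
    K.subtypeL.hasFDerivAt.comp p hf.hasFDerivAt
  rw [h.fderiv]
  exact (fderiv ℝ f p v).2

/-- The product of the line of parameters with an open set of times. -/
abbrev strip (T : Opens ℝ) : Set (ℝ × ℝ) := univ ×ˢ (T : Set ℝ)

theorem isOpen_strip (T : Opens ℝ) : IsOpen (strip T) := isOpen_univ.prod T.2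

theorem hasDerivAt_integral_slice {T : Opens ℝ} {K : Set ℝ} (hK : IsCompact K)
    (hKT : K ⊆ T) {f : ℝ × ℝ → ℝ} (hf : ContDiffOn ℝ ∞ f (strip T)) :
    HasDerivAt (fun s => ∫ x in K, f (s, x)) (∫ x in K, fderiv ℝ f (0, x) (1, 0)) 0 := by
  have hfd : ContinuousOn (fun p => fderiv ℝ f p (1, 0)) (strip T) :=
    (hf.continuousOn_fderiv_of_isOpen (isOpen_strip T) (by simp)).clm_apply continuousOn_const
  have hsub : ∀ s : ℝ, MapsTo (fun x : ℝ => (s, x)) K (strip T) := fun s x hx => ⟨mem_univ _, hKT hx⟩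
  have hcs : ∀ s : ℝ, ContinuousOn (fun x => f (s, x)) K := fun s =>
    hf.continuousOn.comp (by fun_prop) (hsub s)
  -- Only parameters near `0` matter; on `[-1, 1] × K` the parameter derivative is bounded by
  -- compactness, which gives the constant dominating function.
  obtain ⟨c, hc⟩ := ((isCompact_Icc (a := (-1 : ℝ)) (b := 1)).prod hK).exists_bound_of_continuousOn
    (hfd.mono (prod_mono (subset_univ _) hKT))
  have hm := hK.measurableSet
  have : IsFiniteMeasure (volume.restrict K) := ⟨by simpa using hK.measure_lt_top⟩
  refine (hasDerivAt_integral_of_dominated_loc_of_deriv_le (μ := volume.restrict K)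
    (F := fun s x => f (s, x)) (F' := fun s x => fderiv ℝ f (s, x) (1, 0)) (bound := fun _ => c)
    (s := Icc (-1) 1) (Icc_mem_nhds (by norm_num) (by norm_num)) ?_ ?_ ?_ ?_ ?_ ?_).2
  · exact Eventually.of_forall fun s => (hcs s).aestronglyMeasurable hm
  · exact (hcs 0).integrableOn_compact hK
  · exact (hfd.comp (by fun_prop) (hsub 0)).aestronglyMeasurable hm
  · filter_upwards [ae_restrict_mem hm] with x hx s hs
    exact hc (s, x) ⟨hs, hx⟩
  · exact integrable_const c
  · filter_upwards [ae_restrict_mem hm] with x hx s hs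
    exact hasDerivAt_slice_fst ((hf.contDiffAt ((isOpen_strip T).mem_nhds
      ⟨mem_univ _, hKT hx⟩)).differentiableAt (by simp))

/-- The integral of the derivative of a function vanishing off a compact set of times. -/
theorem integral_deriv_eq_zero_of_compact {T : Opens ℝ} {K : Set ℝ} (hK : IsCompact K)
    (hKT : K ⊆ T) {h h' : ℝ → ℝ} (hd : ∀ x ∈ T, HasDerivAt h (h' x) x)
    (hc : ContinuousOn h' T) (hz : ∀ x ∈ T, x ∉ K → h x = 0) : ∫ x in K, h' x = 0 := by
  have hm := hK.measurableSet
  -- Extension by zero stays differentiable: near a point of `K` the indicator agrees with `h`,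
  -- which already vanishes on `T` off `K`, and the complement of `K` is open.
  have key : ∀ x, HasDerivAt (K.indicator h) (K.indicator h' x) x := by
    intro x
    have hoff : x ∉ K → HasDerivAt (K.indicator h) 0 x := fun hx => by
      refine (hasDerivAt_const x (0 : ℝ)).congr_of_eventuallyEq ?_
      filter_upwards [hK.isClosed.isOpen_compl.mem_nhds hx] with y hy
      exact indicator_of_notMem hy h
    by_cases hx : x ∈ K
    · rw [indicator_of_mem hx]
      refine (hd x (hKT hx)).congr_of_eventuallyEq ?_
      filter_upwards [T.2.mem_nhds (hKT hx)] with y hy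
      by_cases hyK : y ∈ K
      · exact indicator_of_mem hyK h
      · rw [indicator_of_notMem hyK, hz y hy hyK]
    · rw [indicator_of_notMem hx]; exact hoff hx
  have hcont : ContinuousOn h K := fun x hx => (hd x (hKT hx)).continuousAt.continuousWithinAt
  have h1 := integral_eq_zero_of_hasDerivAt_of_integrable key
    (((hc.mono hKT).integrableOn_compact hK).integrable_indicator hm)
    ((hcont.integrableOn_compact hK).integrable_indicator hm)
  rwa [integral_indicator hm] at h1

/-- The fundamental lemma of the calculus of variations. -/
theorem eq_zero_of_integral_test_eq_zero {T : Opens ℝ} {q : ℝ → ℝ} (hq : ContinuousOn q T)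
    (h : ∀ f : ℝ → ℝ, ContDiff ℝ ∞ f → HasCompactSupport f → tsupport f ⊆ T →
      ∫ x in tsupport f, f x * q x = 0) {x : ℝ} (hx : x ∈ T) : q x = 0 := by
  have h1 := T.2.ae_eq_zero_of_integral_contDiff_smul_eq_zero (μ := volume)
    (hq.locallyIntegrableOn T.2.measurableSet) (fun f hf hc hs => by
      rw [← h f hf hc hs]
      refine (setIntegral_eq_integral_of_forall_compl_eq_zero fun x hx => ?_).symm
      simp [image_eq_zero_of_notMem_tsupport hx])
  have h2 : q =ᵐ[volume.restrict (T : Set ℝ)] fun _ => 0 := by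
    rw [Filter.EventuallyEq, ae_restrict_iff' (show MeasurableSet (T : Set ℝ) from T.2.measurableSet)]
    exact h1
  exact Measure.eqOn_open_of_ae_eq h2 T.2 hq continuousOn_const hx

end Calculus

/-! ### Replacing curves on `T` by functions on `ℝ` that are smooth on `T`. -/

section Time

open scoped Topology
open Filter

variable {T : Opens ℝ}
  {EX : Type*} [NormedAddCommGroup EX] [NormedSpace ℝ EX] {HX : Type*} [TopologicalSpace HX]
  {X : Type*} [TopologicalSpace X] [ChartedSpace HX X] {J : ModelWithCorners ℝ EX HX}
  {EY : Type*} [NormedAddCommGroup EY] [NormedSpace ℝ EY] {HY : Type*} [TopologicalSpace HY]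
  {Y : Type*} [TopologicalSpace Y] [ChartedSpace HY Y] {K : ModelWithCorners ℝ EY HY}
  {V : Type*} [NormedAddCommGroup V] [NormedSpace ℝ V]

theorem contMDiff_of_strip {H : ℝ × ℝ → X} (hH : ContMDiffOn 𝓘(ℝ, ℝ × ℝ) J ∞ H (strip T)) :
    ContMDiff (𝓘(ℝ, ℝ).prod 𝓘(ℝ, ℝ)) J ∞ (fun p : ℝ × T => H (p.1, (p.2 : ℝ))) :=
  hH.comp_contMDiff (contMDiff_fst.prodMk_space (contMDiff_subtype_val.comp contMDiff_snd))
    fun p => ⟨mem_univ _, p.2.2⟩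

theorem setIntegral_comap_subtype {S : Set ℝ} (hS : MeasurableSet S) (C : Set S) (f : ℝ → ℝ) :
    ∫ t in C, f t ∂(Measure.comap ((↑) : S → ℝ) volume) = ∫ x in (↑) '' C, f x := by
  have h := (MeasurableEmbedding.subtype_coe hS).setIntegral_map
    (μ := Measure.comap ((↑) : S → ℝ) volume) f ((↑) '' C)
  rw [preimage_image_eq _ Subtype.val_injective, map_comap_subtype_coe hS,
    Measure.restrict_restrict_of_subset] at h
  · exact h.symm
  · rintro _ ⟨x, _, rfl⟩
    exact x.2

theorem setIntegral_comap_coe (C : Set T) (f : ℝ → ℝ) :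
    ∫ t in C, f t ∂(Measure.comap ((↑) : T → ℝ) volume) = ∫ x in (↑) '' C, f x :=
  setIntegral_comap_subtype (S := T) T.2.measurableSet C f

/-- The velocity of a composite curve. -/
theorem velocity_comp {φ : X → Y} {γ : T → X} {t : T} (hφ : MDifferentiableAt J K φ (γ t))
    (hγ : MDifferentiableAt 𝓘(ℝ, ℝ) J γ t) :
    velocity K (fun s => φ (γ s)) t = mfderiv J K φ (γ t) (velocity J γ t) :=
  DFunLike.congr_fun (mfderiv_comp t hφ hγ) (1 : ℝ)

variable [Nonempty T]

open Classical in
/-- A retraction of `ℝ` onto the set of times `T`. -/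
def toTime (T : Opens ℝ) [Nonempty T] (x : ℝ) : T :=
  if h : x ∈ T then ⟨x, h⟩ else Classical.arbitrary T

theorem toTime_coe (t : T) : toTime T (t : ℝ) = t := by simp [toTime]

theorem coe_toTime {x : ℝ} (hx : x ∈ T) : (toTime T x : ℝ) = x := by simp [toTime, hx]

theorem contMDiffOn_toTime : ContMDiffOn 𝓘(ℝ, ℝ) 𝓘(ℝ, ℝ) ∞ (toTime T) T := by
  intro x hx
  refine ContMDiffAt.contMDiffWithinAt ?_
  refine (contMDiffAt_subtype_iff (U := T) (f := toTime T) (x := ⟨x, hx⟩)).1 ?_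
  simp only [toTime_coe]
  exact contMDiffAt_id

theorem hasMFDerivAt_toTime (t : T) :
    HasMFDerivAt 𝓘(ℝ, ℝ) 𝓘(ℝ, ℝ) (toTime T) (t : ℝ) (ContinuousLinearMap.id ℝ ℝ) := by
  refine ⟨(contMDiffOn_toTime.contMDiffAt (T.2.mem_nhds t.2)).continuousAt, ?_⟩
  have h : HasFDerivAt (fun x : ℝ => (toTime T x : ℝ)) (ContinuousLinearMap.id ℝ ℝ) (t : ℝ) := by
    refine (hasFDerivAt_id (t : ℝ)).congr_of_eventuallyEq ?_
    filter_upwards [T.2.mem_nhds t.2] with x hx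
    exact coe_toTime hx
  exact h.hasFDerivWithinAt

theorem contMDiffOn_comp_toTime {f : T → X} (hf : ContMDiff 𝓘(ℝ, ℝ) J ∞ f) :
    ContMDiffOn 𝓘(ℝ, ℝ) J ∞ (fun x => f (toTime T x)) T :=
  hf.comp_contMDiffOn contMDiffOn_toTime

theorem velocity_eq_mfderiv {f : T → X} (hf : ContMDiff 𝓘(ℝ, ℝ) J ∞ f) (t : T) :
    (velocity J f t : EX) = (mfderiv 𝓘(ℝ, ℝ) J (fun x => f (toTime T x)) (t : ℝ) : ℝ →L[ℝ] EX) 1 := by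
  have h1 : MDifferentiableAt 𝓘(ℝ, ℝ) J f (toTime T t) := hf.mdifferentiableAt (by simp)
  have h2 := (h1.hasMFDerivAt.comp (t : ℝ) (hasMFDerivAt_toTime t)).mfderiv
  -- `toTime T t` equals `t` only propositionally, so the point at which the derivative is taken is
  -- generalized first.
  have h3 : ∀ t' : T, t' = t → (velocity J f t : EX) =
      (mfderiv 𝓘(ℝ, ℝ) J f t' : ℝ →L[ℝ] EX) (1 : ℝ) := by
    rintro _ rfl; rfl
  rw [h3 _ (toTime_coe t)]
  exact (DFunLike.congr_fun h2 (1 : ℝ)).symm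

theorem vectorVelocity_eq_deriv {f : T → V} (hf : ContMDiff 𝓘(ℝ, ℝ) 𝓘(ℝ, V) ∞ f) (t : T) :
    vectorVelocity f t = deriv (fun x => f (toTime T x)) t := by
  have h := velocity_eq_mfderiv hf t
  have h2 : (mfderiv 𝓘(ℝ, ℝ) 𝓘(ℝ, V) (fun x => f (toTime T x)) (t : ℝ) : ℝ →L[ℝ] V) =
    fderiv ℝ (fun x => f (toTime T x)) t := mfderiv_eq_fderiv
  rw [h2] at h
  exact h

theorem contDiffOn_comp_toTime {f : T → V} (hf : ContMDiff 𝓘(ℝ, ℝ) 𝓘(ℝ, V) ∞ f) :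
    ContDiffOn ℝ ∞ (fun x => f (toTime T x)) T :=
  contMDiffOn_iff_contDiffOn.1 (contMDiffOn_comp_toTime hf)

theorem contMDiffOn_family {Γ : ℝ → T → X}
    (hΓ : ContMDiff (𝓘(ℝ, ℝ).prod 𝓘(ℝ, ℝ)) J ∞ (fun p : ℝ × T => Γ p.1 p.2)) :
    ContMDiffOn 𝓘(ℝ, ℝ × ℝ) J ∞ (fun p : ℝ × ℝ => Γ p.1 (toTime T p.2)) (strip T) := by
  refine hΓ.comp_contMDiffOn (f := fun p : ℝ × ℝ => (p.1, toTime T p.2)) ?_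
  exact contDiff_fst.contMDiff.contMDiffOn.prodMk
    (contMDiffOn_toTime.comp contDiff_snd.contMDiff.contMDiffOn fun p hp => hp.2)

end Time

/-! ### Pullbacks of `dt`, `λ`, `θ` and the Lagrangian forms along sections. -/

namespace Data

open scoped Topology
open Filter

variable {E : Type*} [NormedAddCommGroup E] [NormedSpace ℝ E]
  {G : Type*} [TopologicalSpace G] [ChartedSpace E G] [Group G]
  {T : Opens ℝ} {D : Data E G}

section Pull

theorem mdifferentiableAt_coe_fst (D : Data E G) (x : T × D.Vel) :
    MDifferentiableAt D.totalModel 𝓘(ℝ, ℝ) (fun y : T × D.Vel => (y.1 : ℝ)) x :=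
  ((contMDiff_subtype_val (n := ∞)).comp contMDiff_fst).mdifferentiableAt (by simp)

theorem pull_dt {γ : T → T × D.Vel} (hγ : (D.problem T).IsSection γ) (t : T) :
    pull D.dt γ t = 1 := by
  have : Nonempty T := ⟨t⟩
  have h1 : pull D.dt γ t = vectorVelocity (fun s => ((γ s).1 : ℝ)) t :=
    (velocity_comp (mdifferentiableAt_coe_fst D _) (hγ.1.mdifferentiableAt (by simp))).symm
  have h2 : (fun s => ((γ s).1 : ℝ)) = ((↑) : T → ℝ) := by
    ext s; exact congrArg Subtype.val (hγ.2 s)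
  rw [h1, h2, vectorVelocity_eq_deriv contMDiff_subtype_val]
  have h3 : (fun x : ℝ => (toTime T x : ℝ)) =ᶠ[𝓝 (t : ℝ)] id := by
    filter_upwards [T.2.mem_nhds t.2] with x hx
    exact coe_toTime hx
  rw [h3.deriv_eq, deriv_id]

theorem pull_mc [LieGroup 𝓘(ℝ, E) ∞ G] [Nonempty T] {γ : T → T × D.Vel}
    (hγ : ContMDiff 𝓘(ℝ, ℝ) D.totalModel ∞ γ) (t : T) :
    pull D.mc γ t = logDeriv E (fun x => (γ (toTime T x)).2.1) (t : ℝ) 1 := by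
  have hg : ContMDiff 𝓘(ℝ, ℝ) 𝓘(ℝ, E) ∞ (fun s => (γ s).2.1) :=
    contMDiff_fst.comp (contMDiff_snd.comp hγ)
  have h1 : pull D.mc γ t = maurerCartan (γ t).2.1 (velocity 𝓘(ℝ, E) (fun s => (γ s).2.1) t) := by
    have h2 := velocity_comp (φ := fun y : T × D.Vel => y.2.1) (J := D.totalModel) (K := 𝓘(ℝ, E))
      (γ := γ) (t := t)
      ((contMDiff_fst.comp contMDiff_snd).mdifferentiableAt (n := ∞) (by simp))
      (hγ.mdifferentiableAt (by simp))
    rw [h2]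
    rfl
  have h3 := velocity_eq_mfderiv hg t
  have h4 := (contMDiffOn_comp_toTime hg).contMDiffAt (T.2.mem_nhds t.2)
  rw [h1, logDeriv_eq_maurerCartan (h4.mdifferentiableAt (by simp))]
  have h5 : ∀ t' : T, t' = t → ∀ v : E, (maurerCartan (γ t').2.1 : E →L[ℝ] E) v =
      (maurerCartan (γ t).2.1 : E →L[ℝ] E) v := by
    rintro _ rfl v; rfl
  exact (congrArg (maurerCartan (γ t).2.1 : E →L[ℝ] E) h3).trans (h5 _ (toTime_coe t) _).symm

theorem pull_θ {γ : T → T × D.Vel} (hγ : (D.problem T).IsSection γ) (t : T) :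
    pull D.θ γ t = pull D.mc γ t -
      ((γ t).2.2.1 - Ad (γ t).2.1⁻¹ ((γ t).2.2.2.1 : E) - ((γ t).2.2.2.2 : E)) := by
  have h := pull_dt hγ t
  unfold pull at h ⊢
  change D.mc (γ t) _ - (D.dt (γ t) _) • _ = _
  rw [h, one_smul]

theorem pull_form {γ : T → T × D.Vel} (hγ : (D.problem T).IsSection γ) (t : T) :
    pull (D.problem T).form γ t = D.L (γ t).2 := by
  have h := pull_dt hγ t
  unfold pull at h ⊢
  change D.L (γ t).2 • (D.dt (γ t) _) = _
  rw [h, smul_eq_mul, mul_one]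

theorem isSection_fst {γ : T → (T × D.Vel) × (E →L[ℝ] ℝ)}
    (hγ : (D.problem T).lepage.IsSection γ) : (D.problem T).IsSection (Prod.fst ∘ γ) :=
  ⟨contMDiff_fst.comp hγ.1, hγ.2⟩

end Pull

end Data

section LepagePull

variable {T : Opens ℝ}
  {EX : Type*} [NormedAddCommGroup EX] [NormedSpace ℝ EX] {HX : Type*} [TopologicalSpace HX]
  {X : Type*} [TopologicalSpace X] [ChartedSpace HX X] {J : ModelWithCorners ℝ EX HX}
  {V : Type*} [NormedAddCommGroup V] [NormedSpace ℝ V]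

/-- The pullback of the form `λ + σ(θ)` of the canonical Lepage equivalent. -/
theorem VariationalProblem.pull_lepage_form (P : VariationalProblem T J X V)
    {γ : T → X × (V →L[ℝ] ℝ)}
    (hγ : ContMDiff 𝓘(ℝ, ℝ) (J.prod 𝓘(ℝ, V →L[ℝ] ℝ)) ∞ γ) (t : T) :
    pull P.lepage.form γ t =
      pull P.form (Prod.fst ∘ γ) t + (γ t).2 (pull P.gen (Prod.fst ∘ γ) t) := by
  have h := velocity_comp (φ := (Prod.fst : X × (V →L[ℝ] ℝ) → X)) (K := J)
    (mdifferentiableAt_fst) (hγ.mdifferentiableAt (by simp) (x := t))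
  have h1 : pull P.lepage.form γ t = P.lepagePoint (γ t).1 (γ t).2
      (velocity J (fun s => (γ s).1) t) := by rw [h]; rfl
  rw [h1]
  rfl

end LepagePull

/-! ### The functions `θ` and `L` along two-parameter families. -/

namespace Data

open scoped Topology
open Filter

variable {E : Type*} [NormedAddCommGroup E] [NormedSpace ℝ E]
  {G : Type*} [TopologicalSpace G] [ChartedSpace E G] [Group G]
  {T : Opens ℝ} {D : Data E G}

/-- The coefficient of `dt` in `θ` along a two-parameter family. -/
def thetaFn (D : Data E G) (F : ℝ × ℝ → D.Vel) (p : ℝ × ℝ) : E :=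
  logDeriv E (fun q => (F q).1) p (0, 1) -
    ((F p).2.1 - Ad (F p).1⁻¹ ((F p).2.2.1 : E) - ((F p).2.2.2 : E))

section Components

variable {M : Type*} [NormedAddCommGroup M] [NormedSpace ℝ M] {F : M → D.Vel} {U : Set M}

theorem contMDiffOn_group (hF : ContMDiffOn 𝓘(ℝ, M) D.velModel ∞ F U) :
    ContMDiffOn 𝓘(ℝ, M) 𝓘(ℝ, E) ∞ (fun p => (F p).1) U :=
  contMDiff_fst.comp_contMDiffOn hF

theorem contDiffOn_J (hF : ContMDiffOn 𝓘(ℝ, M) D.velModel ∞ F U) :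
    ContDiffOn ℝ ∞ (fun p => (F p).2.1) U :=
  contMDiffOn_iff_contDiffOn.1
    (contMDiff_fst.comp_contMDiffOn (contMDiff_snd.comp_contMDiffOn hF))

theorem contDiffOn_α_subtype (hF : ContMDiffOn 𝓘(ℝ, M) D.velModel ∞ F U) :
    ContDiffOn ℝ ∞ (fun p => (F p).2.2.1) U :=
  contMDiffOn_iff_contDiffOn.1 (contMDiff_fst.comp_contMDiffOn (contMDiff_snd.comp_contMDiffOn
    (contMDiff_snd.comp_contMDiffOn hF)))

theorem contDiffOn_β_subtype (hF : ContMDiffOn 𝓘(ℝ, M) D.velModel ∞ F U) :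
    ContDiffOn ℝ ∞ (fun p => (F p).2.2.2) U :=
  contMDiffOn_iff_contDiffOn.1 (contMDiff_snd.comp_contMDiffOn (contMDiff_snd.comp_contMDiffOn
    (contMDiff_snd.comp_contMDiffOn hF)))

theorem contDiffOn_α (hF : ContMDiffOn 𝓘(ℝ, M) D.velModel ∞ F U) :
    ContDiffOn ℝ ∞ (fun p => ((F p).2.2.1 : E)) U :=
  D.𝔞.subtypeL.contDiff.comp_contDiffOn (contDiffOn_α_subtype hF)

theorem contDiffOn_β (hF : ContMDiffOn 𝓘(ℝ, M) D.velModel ∞ F U) :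
    ContDiffOn ℝ ∞ (fun p => ((F p).2.2.2 : E)) U :=
  D.𝔟.subtypeL.contDiff.comp_contDiffOn (contDiffOn_β_subtype hF)

theorem contDiffOn_L (hF : ContMDiffOn 𝓘(ℝ, M) D.velModel ∞ F U) :
    ContDiffOn ℝ ∞ (fun p => D.L (F p)) U := by
  have hJ := contDiffOn_J hF
  unfold L
  exact ((contDiffOn_const.mul ((D.B.contDiff.comp_contDiffOn hJ).clm_apply hJ)).sub
    (D.μ.contDiff.comp_contDiffOn (contDiffOn_α hF))).sub
    (D.ν.contDiff.comp_contDiffOn (contDiffOn_β hF))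

theorem hasDerivAt_L {c : ℝ → D.Vel} {s : ℝ} {J' α' β' : E}
    (hJ : HasDerivAt (fun r => (c r).2.1) J' s) (hα : HasDerivAt (fun r => ((c r).2.2.1 : E)) α' s)
    (hβ : HasDerivAt (fun r => ((c r).2.2.2 : E)) β' s) :
    HasDerivAt (fun r => D.L (c r)) (D.B (c s).2.1 J' - D.μ α' - D.ν β') s := by
  unfold L
  have h1 := ((D.B.hasFDerivAt.comp_hasDerivAt s hJ).clm_apply hJ).const_mul (1 / 2 : ℝ)
  have h2 := (h1.sub (D.μ.hasFDerivAt.comp_hasDerivAt s hα)).sub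
    (D.ν.hasFDerivAt.comp_hasDerivAt s hβ)
  refine h2.congr_deriv ?_
  change 1 / 2 * (D.B J' (c s).2.1 + D.B (c s).2.1 J') - D.μ α' - D.ν β' = _
  rw [D.symm J' (c s).2.1]
  ring

end Components

theorem isSection_family {Γ : ℝ → T → T × D.Vel}
    (hΓ : ContMDiff (𝓘(ℝ, ℝ).prod 𝓘(ℝ, ℝ)) D.totalModel ∞ (fun p : ℝ × T => Γ p.1 p.2))
    (hsec : ∀ s t, (Γ s t).1 = t) (s : ℝ) : (D.problem T).IsSection (Γ s) :=
  ⟨hΓ.comp (contMDiff_const.prodMk contMDiff_id), hsec s⟩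

variable [LieGroup 𝓘(ℝ, E) ∞ G]

theorem contDiffOn_logDeriv {M : Type*} [NormedAddCommGroup M] [NormedSpace ℝ M] {g : M → G}
    {U : Set M} (hU : IsOpen U) (hg : ContMDiffOn 𝓘(ℝ, M) 𝓘(ℝ, E) ∞ g U) :
    ContDiffOn ℝ ∞ (logDeriv E g) U :=
  fun _ hp => (contDiffAt_logDeriv (hg.contMDiffAt (hU.mem_nhds hp))).contDiffWithinAt

theorem contDiffOn_Ad_inv {M : Type*} [NormedAddCommGroup M] [NormedSpace ℝ M] {g : M → G}
    {U : Set M} (hU : IsOpen U) (hg : ContMDiffOn 𝓘(ℝ, M) 𝓘(ℝ, E) ∞ g U) :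
    ContDiffOn ℝ ∞ (fun q => (Ad (g q)⁻¹ : E →L[ℝ] E)) U :=
  fun _ hp => (contDiffAt_Ad_inv hU hp hg).contDiffWithinAt

theorem contDiffOn_thetaFn {F : ℝ × ℝ → D.Vel}
    (hF : ContMDiffOn 𝓘(ℝ, ℝ × ℝ) D.velModel ∞ F (strip T)) :
    ContDiffOn ℝ ∞ (D.thetaFn F) (strip T) := by
  have hg := contMDiffOn_group hF
  exact ((contDiffOn_logDeriv (isOpen_strip T) hg).clm_apply contDiffOn_const).sub
    (((contDiffOn_J hF).sub ((contDiffOn_Ad_inv (isOpen_strip T) hg).clm_apply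
      (contDiffOn_α hF))).sub (contDiffOn_β hF))

theorem pull_mc_family [Nonempty T] {Γ : ℝ → T → T × D.Vel}
    (hΓ : ContMDiff (𝓘(ℝ, ℝ).prod 𝓘(ℝ, ℝ)) D.totalModel ∞ (fun p : ℝ × T => Γ p.1 p.2))
    (s : ℝ) (t : T) :
    pull D.mc (Γ s) t =
      logDeriv E (fun p : ℝ × ℝ => (Γ p.1 (toTime T p.2)).2.1) (s, (t : ℝ)) (0, 1) := by
  have hs : ContMDiff 𝓘(ℝ, ℝ) D.totalModel ∞ (Γ s) :=
    hΓ.comp (contMDiff_const.prodMk contMDiff_id)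
  have hF := contMDiffOn_family hΓ
  have hg : ContMDiffOn 𝓘(ℝ, ℝ × ℝ) 𝓘(ℝ, E) ∞
      (fun p : ℝ × ℝ => (Γ p.1 (toTime T p.2)).2.1) (strip T) :=
    contMDiffOn_group (D := D) (contMDiff_snd.comp_contMDiffOn hF)
  have hk : HasFDerivAt (fun x : ℝ => (s, x)) (ContinuousLinearMap.inr ℝ ℝ ℝ) (t : ℝ) :=
    (hasFDerivAt_const s _).prodMk (hasFDerivAt_id _)
  have h := logDeriv_comp (F := fun p : ℝ × ℝ => (Γ p.1 (toTime T p.2)).2.1)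
    (k := fun x : ℝ => (s, x)) (p := (t : ℝ))
    (hg.contMDiffAt ((isOpen_strip T).mem_nhds ⟨mem_univ _, t.2⟩)) hk.differentiableAt
  rw [pull_mc hs]
  change logDeriv E ((fun p : ℝ × ℝ => (Γ p.1 (toTime T p.2)).2.1) ∘ fun x : ℝ => (s, x)) _ _ = _
  rw [h, hk.fderiv]
  simp

theorem pull_θ_family [Nonempty T] {Γ : ℝ → T → T × D.Vel}
    (hΓ : ContMDiff (𝓘(ℝ, ℝ).prod 𝓘(ℝ, ℝ)) D.totalModel ∞ (fun p : ℝ × T => Γ p.1 p.2))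
    (hsec : ∀ s t, (Γ s t).1 = t) (s : ℝ) (t : T) :
    pull D.θ (Γ s) t = D.thetaFn (fun p => (Γ p.1 (toTime T p.2)).2) (s, (t : ℝ)) := by
  rw [pull_θ (isSection_family hΓ hsec s), pull_mc_family hΓ, thetaFn]
  simp only [toTime_coe]

/-- The derivative of `θ` along a family in the direction of the parameter: with `u` and `w` the
logarithmic derivatives of the group component in the parameter and in time,
`∂θ = ∂ₜu - [u, w] - [u, Ad α] + Ad ∂α + ∂β - ∂J`. -/
theorem hasDerivAt_thetaFn {F : ℝ × ℝ → D.Vel}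
    (hF : ContMDiffOn 𝓘(ℝ, ℝ × ℝ) D.velModel ∞ F (strip T)) {s x : ℝ} (hx : x ∈ T) :
    HasDerivAt (fun r => D.thetaFn F (r, x))
      (deriv (fun y => logDeriv E (fun q => (F q).1) (s, y) (1, 0)) x
        - brCLM G (logDeriv E (fun q => (F q).1) (s, x) (1, 0))
          (logDeriv E (fun q => (F q).1) (s, x) (0, 1) + Ad (F (s, x)).1⁻¹ ((F (s, x)).2.2.1 : E))
        + Ad (F (s, x)).1⁻¹ (fderiv ℝ (fun p => ((F p).2.2.1 : E)) (s, x) (1, 0))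
        + fderiv ℝ (fun p => ((F p).2.2.2 : E)) (s, x) (1, 0)
        - fderiv ℝ (fun p => (F p).2.1) (s, x) (1, 0)) s := by
  have hO := isOpen_strip T
  have hp : (s, x) ∈ strip T := ⟨mem_univ _, hx⟩
  have hg := contMDiffOn_group hF
  have hld := (contDiffAt_logDeriv (hg.contMDiffAt (hO.mem_nhds hp))).differentiableAt
    (by simp)
  have had := (contDiffAt_Ad_inv hO hp hg).differentiableAt (by simp)
  have h1 := (hasDerivAt_slice_fst hld).clm_apply (hasDerivAt_const s ((0, 1) : ℝ × ℝ))
  have h2 := (hasDerivAt_slice_fst had).clm_apply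
    (hasDerivAt_slice_fst ((contDiffOn_α hF).contDiffAt (hO.mem_nhds hp) |>.differentiableAt
      (by simp)))
  have hJ := hasDerivAt_slice_fst ((contDiffOn_J hF).contDiffAt (hO.mem_nhds hp)
    |>.differentiableAt (by simp))
  have hβ := hasDerivAt_slice_fst ((contDiffOn_β hF).contDiffAt (hO.mem_nhds hp)
    |>.differentiableAt (by simp))
  have h := h1.sub ((hJ.sub h2).sub hβ)
  have h3 := ((hasDerivAt_slice_snd hld).clm_apply (hasDerivAt_const x ((1, 0) : ℝ × ℝ))).deriv
  have hmc := maurerCartan_equation hO hp hg (1, 0) (0, 1)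
  have hAd := fderiv_Ad_inv hO hp hg (1, 0) ((F (s, x)).2.2.1 : E)
  refine h.congr_deriv ?_
  rw [h3, hAd]
  simp only [map_zero, add_zero, map_add]
  -- The Maurer–Cartan equation trades the parameter derivative of `w` for the time derivative of
  -- `u`, at the cost of `-[u, w]`.
  rw [sub_eq_iff_eq_add.1 hmc]
  abel

end Data

/-! ### The derivative of the action in the parameter. -/

section Action

open scoped Topology
open Filter

variable {T : Opens ℝ}

theorem hasDerivAt_action {C : Set T} (hC : IsCompact C) {a : ℝ → T → ℝ} {f : ℝ × ℝ → ℝ}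
    (hf : ContDiffOn ℝ ∞ f (strip T)) (ha : ∀ s t, a s t = f (s, (t : ℝ))) :
    HasDerivAt (fun s : ℝ => ∫ t in C, a s t ∂(Measure.comap ((↑) : T → ℝ) volume))
      (∫ x in (↑) '' C, fderiv ℝ f (0, x) (1, 0)) 0 := by
  have h : (fun s : ℝ => ∫ t in C, a s t ∂(Measure.comap ((↑) : T → ℝ) volume)) =
      fun s => ∫ x in ((↑) : T → ℝ) '' C, f (s, x) := by
    ext s
    simp only [ha]
    exact setIntegral_comap_coe C fun x => f (s, x)
  rw [h]
  refine hasDerivAt_integral_slice (hC.image continuous_subtype_val) ?_ hf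
  rintro _ ⟨t, _, rfl⟩
  exact t.2

theorem hasDerivAt_action_of_isEmpty [IsEmpty T] (C : Set T) (a : ℝ → T → ℝ) :
    HasDerivAt (fun s : ℝ => ∫ t in C, a s t ∂(Measure.comap ((↑) : T → ℝ) volume)) 0 0 := by
  simp only [eq_empty_of_isEmpty C, setIntegral_empty]
  exact hasDerivAt_const 0 0

theorem isCompact_preimage_tsupport {f : ℝ → ℝ} (hf : HasCompactSupport f)
    (hs : tsupport f ⊆ T) : IsCompact (((↑) : T → ℝ) ⁻¹' tsupport f) :=
  Topology.IsInducing.subtypeVal.isCompact_preimage' hf (by simpa using hs)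

theorem image_preimage_tsupport {f : ℝ → ℝ} (hs : tsupport f ⊆ T) :
    ((↑) : T → ℝ) '' (((↑) : T → ℝ) ⁻¹' tsupport f) = tsupport f :=
  image_preimage_eq_of_subset (by simpa using hs)

/-- If `f` is smooth on the strip, the derivative of the action vanishes and the derivative of `f`
in the parameter at `0` is `d`, then the integral of `d` vanishes. -/
theorem integral_eq_zero_of_action {C : Set T} (hC : IsCompact C) {a : ℝ → T → ℝ} {f : ℝ × ℝ → ℝ}
    (hf : ContDiffOn ℝ ∞ f (strip T)) (ha : ∀ s t, a s t = f (s, (t : ℝ))) {d : ℝ → ℝ}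
    (hd : ∀ t ∈ C, HasDerivAt (fun s => f (s, (t : ℝ))) (d t) 0)
    (h0 : HasDerivAt (fun s : ℝ => ∫ t in C, a s t ∂(Measure.comap ((↑) : T → ℝ) volume)) 0 0) :
    ∫ x in ((↑) : T → ℝ) '' C, d x = 0 := by
  rw [← (hasDerivAt_action hC hf ha).unique h0]
  refine setIntegral_congr_fun (hC.image continuous_subtype_val).measurableSet ?_
  rintro _ ⟨t, ht, rfl⟩
  exact (hd t ht).unique (hasDerivAt_slice_fst
    ((hf.contDiffAt ((isOpen_strip T).mem_nhds ⟨mem_univ _, t.2⟩)).differentiableAt (by simp)))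

theorem action_hasDerivAt_zero {C : Set T} (hC : IsCompact C) {a : ℝ → T → ℝ} {f : ℝ × ℝ → ℝ}
    (hf : ContDiffOn ℝ ∞ f (strip T)) (ha : ∀ s t, a s t = f (s, (t : ℝ))) {d : ℝ → ℝ}
    (hd : ∀ t ∈ C, HasDerivAt (fun s => f (s, (t : ℝ))) (d t) 0)
    (h0 : ∫ x in ((↑) : T → ℝ) '' C, d x = 0) :
    HasDerivAt (fun s : ℝ => ∫ t in C, a s t ∂(Measure.comap ((↑) : T → ℝ) volume)) 0 0 := by
  refine (hasDerivAt_action hC hf ha).congr_deriv ?_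
  refine Eq.trans ?_ h0
  refine (setIntegral_congr_fun (hC.image continuous_subtype_val).measurableSet ?_).symm
  rintro _ ⟨t, ht, rfl⟩
  exact (hd t ht).unique (hasDerivAt_slice_fst
    ((hf.contDiffAt ((isOpen_strip T).mem_nhds ⟨mem_univ _, t.2⟩)).differentiableAt (by simp)))

theorem VariationalProblem.isAdmissible_lepage {EX : Type*} [NormedAddCommGroup EX]
    [NormedSpace ℝ EX] {HX : Type*} [TopologicalSpace HX] {X : Type*} [TopologicalSpace X]
    [ChartedSpace HX X] {J : ModelWithCorners ℝ EX HX} {V : Type*} [NormedAddCommGroup V]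
    [NormedSpace ℝ V] (P : VariationalProblem T J X V) (Γ : ℝ → T → X × (V →L[ℝ] ℝ)) :
    P.lepage.IsAdmissible Γ := fun t => by
  have h : (fun s : ℝ => pull P.lepage.gen (Γ s) t) = fun _ => 0 := rfl
  rw [h]
  exact hasDerivAt_const 0 0

end Action

/-! ### The integrand `L + σ(θ)` along families of sections. -/

namespace Data

open scoped Topology
open Filter

variable {E : Type*} [NormedAddCommGroup E] [NormedSpace ℝ E]
  {G : Type*} [TopologicalSpace G] [ChartedSpace E G] [Group G]
  {T : Opens ℝ} {D : Data E G}

/-- The coefficient of `dt` in `L dt + σ(θ)` along a two-parameter family. -/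
def lepageFn (D : Data E G) (F : ℝ × ℝ → D.Vel) (S : ℝ × ℝ → E →L[ℝ] ℝ) (p : ℝ × ℝ) : ℝ :=
  D.L (F p) + S p (D.thetaFn F p)

section Projections

variable [FiniteDimensional ℝ E]

/-- Both functionals vanish on `𝔟`, so equality needs testing only on `𝔞`, the space in which `α`
varies. -/
theorem projB0_sub_eq_zero_iff (φ : E →L[ℝ] ℝ) :
    D.projB0 φ - D.μ = 0 ↔ ∀ x : D.𝔞, φ x = D.μ x := by
  rw [sub_eq_zero]
  constructor
  · intro h x
    simpa [projB0] using DFunLike.congr_fun h (x : E)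
  · intro h
    ext ξ
    obtain ⟨x, y, hx, hy, rfl⟩ := Submodule.codisjoint_iff_exists_add_eq.1 D.isCompl.codisjoint ξ
    lift x to D.𝔞 using hx
    lift y to D.𝔟 using hy
    simp [projB0, h x, D.μ_mem _ y.2]

theorem projA0_sub_eq_zero_iff (φ : E →L[ℝ] ℝ) :
    D.projA0 φ - D.ν = 0 ↔ ∀ x : D.𝔟, φ x = D.ν x := by
  rw [sub_eq_zero]
  constructor
  · intro h x
    simpa [projA0] using DFunLike.congr_fun h (x : E)
  · intro h
    ext ξ
    obtain ⟨x, y, hx, hy, rfl⟩ := Submodule.codisjoint_iff_exists_add_eq.1 D.isCompl.symm.codisjoint ξ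
    lift x to D.𝔟 using hx
    lift y to D.𝔞 using hy
    simp [projA0, h x, D.ν_mem _ y.2]

end Projections

section FamilyComponents

variable [Nonempty T]

/-- The velocity components of a family of sections, over the plane. -/
def famVel (Γ : ℝ → T → T × D.Vel) (p : ℝ × ℝ) : D.Vel := (Γ p.1 (toTime T p.2)).2

theorem contMDiffOn_famVel {Γ : ℝ → T → T × D.Vel}
    (hΓ : ContMDiff (𝓘(ℝ, ℝ).prod 𝓘(ℝ, ℝ)) D.totalModel ∞ (fun p : ℝ × T => Γ p.1 p.2)) :
    ContMDiffOn 𝓘(ℝ, ℝ × ℝ) D.velModel ∞ (famVel Γ) (strip T) :=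
  contMDiff_snd.comp_contMDiffOn (contMDiffOn_family hΓ)

theorem contDiffOn_famMult {Γ : ℝ → T → (T × D.Vel) × (E →L[ℝ] ℝ)}
    (hΓ : ContMDiff (𝓘(ℝ, ℝ).prod 𝓘(ℝ, ℝ)) (D.totalModel.prod 𝓘(ℝ, E →L[ℝ] ℝ)) ∞
      (fun p : ℝ × T => Γ p.1 p.2)) :
    ContDiffOn ℝ ∞ (fun p : ℝ × ℝ => (Γ p.1 (toTime T p.2)).2) (strip T) :=
  contMDiffOn_iff_contDiffOn.1 (contMDiff_snd.comp_contMDiffOn (contMDiffOn_family hΓ))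

theorem pull_form_family {Γ : ℝ → T → T × D.Vel}
    (hΓ : ContMDiff (𝓘(ℝ, ℝ).prod 𝓘(ℝ, ℝ)) D.totalModel ∞ (fun p : ℝ × T => Γ p.1 p.2))
    (hsec : ∀ s t, (Γ s t).1 = t) (s : ℝ) (t : T) :
    pull (D.problem T).form (Γ s) t = D.L (famVel Γ (s, (t : ℝ))) := by
  rw [pull_form (isSection_family hΓ hsec s), famVel, toTime_coe]

end FamilyComponents

variable [LieGroup 𝓘(ℝ, E) ∞ G]

theorem contDiffOn_lepageFn {F : ℝ × ℝ → D.Vel} {S : ℝ × ℝ → E →L[ℝ] ℝ}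
    (hF : ContMDiffOn 𝓘(ℝ, ℝ × ℝ) D.velModel ∞ F (strip T)) (hS : ContDiffOn ℝ ∞ S (strip T)) :
    ContDiffOn ℝ ∞ (D.lepageFn F S) (strip T) :=
  (contDiffOn_L hF).add (hS.clm_apply (contDiffOn_thetaFn hF))

theorem logDeriv_fst_eq_zero {g : ℝ × ℝ → G} {x : ℝ} (hx : x ∈ T)
    (hg : ContMDiffOn 𝓘(ℝ, ℝ × ℝ) 𝓘(ℝ, E) ∞ g (strip T)) (h : ∀ s, g (s, x) = g (0, x)) :
    logDeriv E g (0, x) (1, 0) = 0 := by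
  have hd := hg.contMDiffAt ((isOpen_strip T).mem_nhds (⟨mem_univ 0, hx⟩ : ((0 : ℝ), x) ∈ strip T))
  have h1 : DifferentiableAt ℝ (fun q => chartOne E G ((g (0, x))⁻¹ * g q)) (0, x) :=
    (contDiffAt_chart (contMDiffAt_const.mul hd) (by simp)).differentiableAt (by simp)
  refine (hasDerivAt_slice_fst h1).unique ?_
  simp only [h]
  exact hasDerivAt_const _ _

section Family

variable [Nonempty T]

theorem pull_lepage_family {Γ : ℝ → T → (T × D.Vel) × (E →L[ℝ] ℝ)}
    (hΓ : ContMDiff (𝓘(ℝ, ℝ).prod 𝓘(ℝ, ℝ)) (D.totalModel.prod 𝓘(ℝ, E →L[ℝ] ℝ)) ∞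
      (fun p : ℝ × T => Γ p.1 p.2))
    (hsec : ∀ s t, (Γ s t).1.1 = t) (s : ℝ) (t : T) :
    pull (D.problem T).lepage.form (Γ s) t =
      D.lepageFn (famVel fun s t => (Γ s t).1) (fun p => (Γ p.1 (toTime T p.2)).2)
        (s, (t : ℝ)) := by
  have hΓ1 : ContMDiff (𝓘(ℝ, ℝ).prod 𝓘(ℝ, ℝ)) D.totalModel ∞ (fun p : ℝ × T => (Γ p.1 p.2).1) :=
    contMDiff_fst.comp hΓ
  have hs : ContMDiff 𝓘(ℝ, ℝ) (D.totalModel.prod 𝓘(ℝ, E →L[ℝ] ℝ)) ∞ (Γ s) :=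
    hΓ.comp (contMDiff_const.prodMk contMDiff_id)
  rw [VariationalProblem.pull_lepage_form _ hs, lepageFn]
  have h1 := pull_form_family (Γ := fun s t => (Γ s t).1) hΓ1 hsec s t
  have h2 := pull_θ_family (Γ := fun s t => (Γ s t).1) hΓ1 hsec s t
  simp only [toTime_coe]
  exact congrArg₂ (· + ·) h1 (congrArg _ h2)

end Family

end Data

/-! ### Algebraic constraints on extremals of the Lepage equivalent. -/

namespace Data

open scoped Topology
open Filter

variable {E : Type*} [NormedAddCommGroup E] [NormedSpace ℝ E]
  {G : Type*} [TopologicalSpace G] [ChartedSpace E G] [Group G]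
  {T : Opens ℝ} {D : Data E G} [LieGroup 𝓘(ℝ, E) ∞ G]

/-- Variations of `J` and `σ` give the constraints `θ = 0` and `J^♭ = σ`. -/
theorem constraints_of_lepage_extremal {γ : T → (T × D.Vel) × (E →L[ℝ] ℝ)}
    (hγ : γ ∈ (D.problem T).lepage.extremals) (t : T) :
    pull D.θ (Prod.fst ∘ γ) t = 0 ∧ D.B (γ t).1.2.2.1 = (γ t).2 := by
  have : Nonempty T := ⟨t⟩
  obtain ⟨⟨hsec, -⟩, hext⟩ := hγ
  have hsec1 := isSection_fst hsec
  have hJs : ContMDiff 𝓘(ℝ, ℝ) 𝓘(ℝ, E) ∞ (fun t => (γ t).1.2.2.1) :=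
    contMDiff_fst.comp (contMDiff_snd.comp (contMDiff_snd.comp hsec1.1))
  have hσs : ContMDiff 𝓘(ℝ, ℝ) 𝓘(ℝ, E →L[ℝ] ℝ) ∞ (fun t => (γ t).2) := contMDiff_snd.comp hsec.1
  have key : ∀ (v : E) (τ : E →L[ℝ] ℝ), D.B (γ t).1.2.2.1 v - (γ t).2 v
      + τ (pull D.θ (Prod.fst ∘ γ) t) = 0 := by
    intro v τ
    let q : ℝ → ℝ := fun x => D.B (γ (toTime T x)).1.2.2.1 v - (γ (toTime T x)).2 v
      + τ (pull D.θ (Prod.fst ∘ γ) (toTime T x))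
    have hq : ContinuousOn q T := by
      have h1 : ContinuousOn (fun x => (γ (toTime T x)).1.2.2.1) T :=
        (contDiffOn_comp_toTime hJs).continuousOn
      have h2 : ContinuousOn (fun x => (γ (toTime T x)).2) T :=
        (contDiffOn_comp_toTime hσs).continuousOn
      have hΓ : ContMDiff (𝓘(ℝ, ℝ).prod 𝓘(ℝ, ℝ)) D.totalModel ∞
          (fun p : ℝ × T => (Prod.fst ∘ γ) p.2) := hsec1.1.comp contMDiff_snd
      have h3 : ContinuousOn (fun x => pull D.θ (Prod.fst ∘ γ) (toTime T x)) T := by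
        have h4 := (contDiffOn_thetaFn (contMDiffOn_famVel (Γ := fun _ => Prod.fst ∘ γ)
          hΓ)).continuousOn.comp (f := fun x : ℝ => ((0 : ℝ), x)) (s := T) (by fun_prop)
            (fun x hx => ⟨mem_univ _, hx⟩)
        refine h4.congr fun x hx => ?_
        have h5 := pull_θ_family (Γ := fun _ => Prod.fst ∘ γ) hΓ (fun _ => hsec1.2) 0 (toTime T x)
        rw [coe_toTime hx] at h5
        exact h5
      exact (((D.B.continuous.comp_continuousOn h1).clm_apply continuousOn_const).sub
        (h2.clm_apply continuousOn_const)).add (τ.continuous.comp_continuousOn h3)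
    have h0 := eq_zero_of_integral_test_eq_zero hq ?_ t.2
    · simpa only [q, toTime_coe] using h0
    intro f hf hcs hsupp
    -- Only `J` and `σ` move, so no time derivative of the variation appears and the fundamental
    -- lemma applies without integration by parts.
    let Γ : ℝ → T → (T × D.Vel) × (E →L[ℝ] ℝ) := fun s t =>
      (((γ t).1.1, (γ t).1.2.1, (γ t).1.2.2.1 + (s * f t) • v, (γ t).1.2.2.2),
        (γ t).2 + (s * f t) • τ)
    have hsf : ContMDiff (𝓘(ℝ, ℝ).prod 𝓘(ℝ, ℝ)) 𝓘(ℝ, ℝ) ∞ (fun p : ℝ × T => p.1 * f p.2) :=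
      contMDiff_fst.mul (hf.contMDiff.comp (contMDiff_subtype_val.comp contMDiff_snd))
    have hγ2 : ContMDiff (𝓘(ℝ, ℝ).prod 𝓘(ℝ, ℝ)) (D.totalModel.prod 𝓘(ℝ, E →L[ℝ] ℝ)) ∞
      (fun p : ℝ × T => γ p.2) := hsec.1.comp contMDiff_snd
    have hΓ : ContMDiff (𝓘(ℝ, ℝ).prod 𝓘(ℝ, ℝ)) (D.totalModel.prod 𝓘(ℝ, E →L[ℝ] ℝ)) ∞
        (fun p : ℝ × T => Γ p.1 p.2) := by
      have h1 := contMDiff_fst.comp hγ2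
      have h2 := contMDiff_snd.comp h1
      have h3 := contMDiff_snd.comp h2
      exact ((contMDiff_fst.comp h1).prodMk ((contMDiff_fst.comp h2).prodMk
        (((contMDiff_fst.comp h3).add (hsf.smul contMDiff_const)).prodMk
          (contMDiff_snd.comp h3)))).prodMk
        ((contMDiff_snd.comp hγ2).add (hsf.smul contMDiff_const))
    have hΓ1 : ContMDiff (𝓘(ℝ, ℝ).prod 𝓘(ℝ, ℝ)) D.totalModel ∞
        (fun p : ℝ × T => (Γ p.1 p.2).1) := contMDiff_fst.comp hΓ
    have hΓs : ∀ s t, (Γ s t).1.1 = t := fun s t => hsec.2 t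
    have hC := isCompact_preimage_tsupport hcs hsupp
    have hvar : (D.problem T).lepage.IsVariation γ (((↑) : T → ℝ) ⁻¹' tsupport f) Γ := by
      refine ⟨hΓ, hΓs, ?_, hC, ?_⟩
      · ext1 t; simp [Γ]
      · intro s t ht
        have : f t = 0 := image_eq_zero_of_notMem_tsupport ht
        simp [Γ, this]
    have hact := hext _ Γ hvar (VariationalProblem.isAdmissible_lepage _ Γ)
    have hint := integral_eq_zero_of_action hC
      (contDiffOn_lepageFn (contMDiffOn_famVel hΓ1) (contDiffOn_famMult hΓ))
      (pull_lepage_family hΓ hΓs) (d := fun x => f x * q x) ?_ hact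
    · rwa [image_preimage_tsupport hsupp] at hint
    intro t _
    -- The group curve, `α` and `β` are fixed, so `θ` changes only through its term `-J dt`.
    have hθ : ∀ s, D.thetaFn (famVel fun s t => (Γ s t).1) (s, (t : ℝ)) =
        pull D.θ (Prod.fst ∘ γ) t - (s * f t) • v := by
      intro s
      have h1 := pull_θ_family (Γ := fun s t => (Γ s t).1) hΓ1 hΓs s t
      have hs := isSection_family (Γ := fun s t => (Γ s t).1) hΓ1 hΓs s
      refine h1.symm.trans ?_
      rw [pull_θ hs, pull_θ hsec1, pull_mc hs.1, pull_mc hsec1.1]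
      simp only [Γ, Function.comp_apply]
      abel
    have hlin : HasDerivAt (fun s : ℝ => s * f t) (f t) 0 := by
      simpa using (hasDerivAt_id (0 : ℝ)).mul_const (f t)
    have hL : HasDerivAt (fun s => D.L (famVel (fun s t => (Γ s t).1) (s, (t : ℝ))))
        (D.B (γ t).1.2.2.1 (f t • v) - D.μ 0 - D.ν 0) 0 := by
      have := hasDerivAt_L (c := fun s => famVel (fun s t => (Γ s t).1) (s, (t : ℝ)))
        (s := 0) (J' := f t • v) (α' := 0) (β' := 0) ?_ ?_ ?_
      · simpa [famVel, Γ, toTime_coe] using this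
      · simp only [famVel, Γ, toTime_coe]
        exact (hlin.smul_const v).const_add _
      · simp only [famVel, Γ]
        exact hasDerivAt_const _ _
      · simp only [famVel, Γ]
        exact hasDerivAt_const _ _
    have hS : HasDerivAt (fun s => (Γ s (toTime T (t : ℝ))).2) (f t • τ) 0 := by
      simp only [Γ, toTime_coe]
      exact (hlin.smul_const τ).const_add _
    have hθd : HasDerivAt (fun s => D.thetaFn (famVel fun s t => (Γ s t).1) (s, (t : ℝ)))
        (-(f t • v)) 0 := by
      simp only [hθ]
      exact (hlin.smul_const v).const_sub _
    have h := hL.add (hS.clm_apply hθd)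
    refine h.congr_deriv ?_
    simp only [hθ, q, toTime_coe, Γ]
    simp
    ring
  constructor
  · refine SeparatingDual.eq_zero_of_forall_dual_eq_zero (R := ℝ) fun τ => ?_
    simpa using key 0 τ
  · ext v
    simpa [sub_eq_zero] using key v 0

end Data

/-! ### Covariance, and sufficiency of the Hamiltonian system. -/

namespace Data

open scoped Topology
open Filter

variable {E : Type*} [NormedAddCommGroup E] [NormedSpace ℝ E]
  {G : Type*} [TopologicalSpace G] [ChartedSpace E G] [Group G]
  {T : Opens ℝ} {D : Data E G} [LieGroup 𝓘(ℝ, E) ∞ G]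

/-- Covariance: extremals of the Lepage equivalent project to extremals. -/
theorem fst_comp_mem_extremals {γ : T → (T × D.Vel) × (E →L[ℝ] ℝ)}
    (hγ : γ ∈ (D.problem T).lepage.extremals) : Prod.fst ∘ γ ∈ (D.problem T).extremals := by
  have hsec := hγ.1.1
  refine ⟨⟨isSection_fst hsec, fun t => (constraints_of_lepage_extremal hγ t).1⟩, ?_⟩
  intro C Γ hΓ hadm
  cases isEmpty_or_nonempty T with
  | inl _ => exact hasDerivAt_action_of_isEmpty _ _
  | inr _ =>
  -- The multiplier is frozen: admissibility makes the first-order change of `σ(θ)` zero, so both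
  -- actions have the same derivative.
  let Γ' : ℝ → T → (T × D.Vel) × (E →L[ℝ] ℝ) := fun s t => (Γ s t, (γ t).2)
  have hσ : ContMDiff (𝓘(ℝ, ℝ).prod 𝓘(ℝ, ℝ)) 𝓘(ℝ, E →L[ℝ] ℝ) ∞ (fun p : ℝ × T => (γ p.2).2) :=
    contMDiff_snd.comp (hsec.1.comp contMDiff_snd)
  have hΓ's : ContMDiff (𝓘(ℝ, ℝ).prod 𝓘(ℝ, ℝ)) (D.totalModel.prod 𝓘(ℝ, E →L[ℝ] ℝ)) ∞
      (fun p : ℝ × T => Γ' p.1 p.2) := hΓ.smooth.prodMk hσ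
  have hvar : (D.problem T).lepage.IsVariation γ C Γ' := by
    refine ⟨hΓ's, hΓ.isSection, ?_, hΓ.compact, ?_⟩
    · ext1 t
      simp [Γ', hΓ.start]
    · intro s t ht
      simp [Γ', hΓ.fixed s t ht]
  have hact := hγ.2 C Γ' hvar (VariationalProblem.isAdmissible_lepage _ Γ')
  have hF := contMDiffOn_famVel hΓ.smooth
  have hLd : ∀ t : T, HasDerivAt (fun s => D.L (famVel Γ (s, (t : ℝ))))
      (fderiv ℝ (fun p => D.L (famVel Γ p)) (0, (t : ℝ)) (1, 0)) 0 := fun t =>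
    hasDerivAt_slice_fst (((contDiffOn_L hF).contDiffAt ((isOpen_strip T).mem_nhds
      ⟨mem_univ _, t.2⟩)).differentiableAt (by simp))
  have hS : ContDiffOn ℝ ∞ (fun p : ℝ × ℝ => (γ (toTime T p.2)).2) (strip T) :=
    contDiffOn_famMult hΓ's
  have hpull : ∀ s t, pull (D.problem T).lepage.form (Γ' s) t =
      D.lepageFn (famVel Γ) (fun p => (γ (toTime T p.2)).2) (s, (t : ℝ)) :=
    pull_lepage_family hΓ's hΓ.isSection
  have hint := integral_eq_zero_of_action hΓ.compact (contDiffOn_lepageFn hF hS) hpull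
    (d := fun x => fderiv ℝ (fun p => D.L (famVel Γ p)) (0, x) (1, 0)) ?_ hact
  · exact action_hasDerivAt_zero hΓ.compact (contDiffOn_L hF)
      (pull_form_family hΓ.smooth hΓ.isSection) (fun t _ => hLd t) hint
  intro t _
  have hθ : HasDerivAt (fun s => D.thetaFn (famVel Γ) (s, (t : ℝ))) 0 0 := by
    have h1 := hadm t
    have h2 : (fun s => pull (D.problem T).gen (Γ s) t) =
        fun s => D.thetaFn (famVel Γ) (s, (t : ℝ)) := by
      ext1 s; exact pull_θ_family hΓ.smooth hΓ.isSection s t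
    rwa [h2] at h1
  have h := (hLd t).add ((hasDerivAt_const (0 : ℝ) (γ (toTime T (t : ℝ))).2).clm_apply hθ)
  refine h.congr_deriv ?_
  simp

theorem adSharp_eq [CompleteSpace E] (κ ξ : E) (φ : E →L[ℝ] ℝ) :
    adSharp G κ φ ξ = φ (brCLM G ξ κ) := by
  rw [adSharp, lieBr_eq_brCLM]

variable [FiniteDimensional ℝ E]

/-- Solutions of the Hamiltonian system are extremals of the Lepage equivalent. -/
theorem hamiltonSolutions_subset : D.hamiltonSolutions T ⊆ (D.problem T).lepage.extremals := by
  have : CompleteSpace E := FiniteDimensional.complete ℝ E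
  rintro γ ⟨hsec, hsol⟩
  refine ⟨⟨hsec, fun t => rfl⟩, ?_⟩
  intro C Γ hΓ _
  cases isEmpty_or_nonempty T with
  | inl _ => exact hasDerivAt_action_of_isEmpty _ _
  | inr _ =>
  have hsec1 := isSection_fst hsec
  have hΓ1 : ContMDiff (𝓘(ℝ, ℝ).prod 𝓘(ℝ, ℝ)) D.totalModel ∞ (fun p : ℝ × T => (Γ p.1 p.2).1) :=
    contMDiff_fst.comp hΓ.smooth
  have hΓs : ∀ s t, (Γ s t).1.1 = t := hΓ.isSection
  have hO := isOpen_strip T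
  set F : ℝ × ℝ → D.Vel := famVel fun s t => (Γ s t).1 with hFdef
  set S : ℝ × ℝ → E →L[ℝ] ℝ := fun p => (Γ p.1 (toTime T p.2)).2 with hSdef
  have hF : ContMDiffOn 𝓘(ℝ, ℝ × ℝ) D.velModel ∞ F (strip T) := contMDiffOn_famVel hΓ1
  have hS : ContDiffOn ℝ ∞ S (strip T) := contDiffOn_famMult hΓ.smooth
  have hg := contMDiffOn_group hF
  -- `u` is the left trivialized variation of the group component. Along a solution the first-order
  -- change of `L + σ(θ)` is the time derivative of `σ(u)`: the `J`, `α` and `β` terms cancel by the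
  -- algebraic equations, and the equation for `σ` absorbs the bracket.
  let u : ℝ × ℝ → E := fun p => logDeriv E (fun q => (F q).1) p (1, 0)
  have hu : ContDiffOn ℝ ∞ u (strip T) := (contDiffOn_logDeriv hO hg).clm_apply contDiffOn_const
  have hsl : MapsTo (fun x : ℝ => ((0 : ℝ), x)) T (strip T) := fun x hx => ⟨mem_univ _, hx⟩
  have hslc : ContDiffOn ℝ ∞ (fun x : ℝ => ((0 : ℝ), x)) T :=
    (contDiff_const.prodMk contDiff_id).contDiffOn
  have hu0 : ContDiffOn ℝ ∞ (fun x => u (0, x)) T := hu.comp hslc hsl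
  have hσ0 : ContMDiff 𝓘(ℝ, ℝ) 𝓘(ℝ, E →L[ℝ] ℝ) ∞ (fun t => (γ t).2) := contMDiff_snd.comp hsec.1
  have hS0' : (fun x => S (0, x)) = fun x => (γ (toTime T x)).2 := by
    ext1 x; simp [S, hΓ.start]
  have hS0 : ContDiffOn ℝ ∞ (fun x => S (0, x)) T := hS.comp hslc hsl
  have hpair : ContDiffOn ℝ ∞ (fun x => S (0, x) (u (0, x))) T := hS0.clm_apply hu0
  have hF0 : ∀ t : T, F (0, (t : ℝ)) = (γ t).1.2 := fun t => by
    simp [F, famVel, hΓ.start, toTime_coe]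
  refine action_hasDerivAt_zero hΓ.compact (contDiffOn_lepageFn hF hS)
    (pull_lepage_family hΓ.smooth hΓs) (d := deriv fun x => S (0, x) (u (0, x))) ?_ ?_
  · intro t _
    obtain ⟨h1, h2, h3, h4, h5⟩ := hsol t
    rw [projB0_sub_eq_zero_iff] at h4
    rw [projA0_sub_eq_zero_iff] at h5
    rw [sub_eq_zero] at h2
    have hmem : ((0 : ℝ), (t : ℝ)) ∈ strip T := ⟨mem_univ _, t.2⟩
    have hnhds := hO.mem_nhds hmem
    have hTn : (T : Set ℝ) ∈ 𝓝 (t : ℝ) := T.2.mem_nhds t.2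
    have hJ := hasDerivAt_slice_fst (((contDiffOn_J hF).contDiffAt hnhds).differentiableAt (by simp))
    have hα := hasDerivAt_slice_fst (((contDiffOn_α hF).contDiffAt hnhds).differentiableAt (by simp))
    have hβ := hasDerivAt_slice_fst (((contDiffOn_β hF).contDiffAt hnhds).differentiableAt (by simp))
    have hαmem : fderiv ℝ (fun p => ((F p).2.2.1 : E)) (0, (t : ℝ)) (1, 0) ∈ D.𝔞 :=
      fderiv_coe_mem (((contDiffOn_α_subtype hF).contDiffAt hnhds).differentiableAt (by simp)) _
    have hβmem : fderiv ℝ (fun p => ((F p).2.2.2 : E)) (0, (t : ℝ)) (1, 0) ∈ D.𝔟 :=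
      fderiv_coe_mem (((contDiffOn_β_subtype hF).contDiffAt hnhds).differentiableAt (by simp)) _
    have hL := hasDerivAt_L (D := D) (c := fun s => F (s, (t : ℝ))) hJ hα hβ
    have hSd := hasDerivAt_slice_fst ((hS.contDiffAt hnhds).differentiableAt (by simp))
    have hθ := hasDerivAt_thetaFn hF (s := 0) t.2
    have h := hL.add (hSd.clm_apply hθ)
    refine h.congr_deriv ?_
    have hθ0 : D.thetaFn F (0, (t : ℝ)) = 0 := by
      have := pull_θ_family (Γ := fun s t => (Γ s t).1) hΓ1 hΓs 0 t
      refine this.symm.trans ?_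
      rw [hΓ.start]
      exact h3
    have hw : logDeriv E (fun q => (F q).1) (0, (t : ℝ)) (0, 1) = pull D.mc (Prod.fst ∘ γ) t := by
      have := pull_mc_family (Γ := fun s t => (Γ s t).1) hΓ1 0 t
      refine this.symm.trans ?_
      rw [hΓ.start]
      rfl
    have hprod := (((hS0.contDiffAt hTn).differentiableAt (by simp)).hasDerivAt.clm_apply
      ((hu0.contDiffAt hTn).differentiableAt (by simp)).hasDerivAt).deriv
    have hSv : deriv (fun x => S (0, x)) (t : ℝ) = vectorVelocity (fun s => (γ s).2) t := by
      rw [hS0', vectorVelocity_eq_deriv hσ0]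
    have hS0t : S (0, (t : ℝ)) = (γ t).2 := by
      have := congrFun hS0' (t : ℝ); simpa only [toTime_coe] using this
    have e1 := h1 (u (0, (t : ℝ)))
    rw [adSharp_eq, add_eq_zero_iff_eq_neg] at e1
    have e2 := h4 ⟨_, hαmem⟩
    have e3 := h5 ⟨_, hβmem⟩
    simp only [AdSharp, ContinuousLinearMap.comp_apply] at e2 e3
    rw [hprod, hSv, hS0t, hθ0, hw, hF0, e1, h2, ← e2, ← e3]
    simp only [map_zero, map_add, map_sub, u]
    ring
  · refine integral_deriv_eq_zero_of_compact (T := T) (hΓ.compact.image continuous_subtype_val) ?_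
      (fun x hx => ((hpair.contDiffAt (T.2.mem_nhds hx)).differentiableAt (by simp)).hasDerivAt)
      (hpair.continuousOn_deriv_of_isOpen T.2 (by simp)) ?_
    · rintro _ ⟨t, _, rfl⟩; exact t.2
    · intro x hx hxC
      -- The boundary term vanishes because the variation is constant in the parameter at times
      -- outside `C`.
      have hu00 : u (0, x) = 0 := by
        refine logDeriv_fst_eq_zero (T := T) hx hg fun s => ?_
        have hxc : toTime T x ∉ C := fun h => hxC ⟨_, h, coe_toTime hx⟩
        simp only [F, famVel, hΓ.fixed _ _ hxc]
      simp [hu00]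

end Data

/-! ### Admissible deformations and the first variation of the constrained problem. -/

namespace Data

open scoped Topology
open Filter

variable {E : Type*} [NormedAddCommGroup E] [NormedSpace ℝ E]
  {G : Type*} [TopologicalSpace G] [ChartedSpace E G] [Group G]
  {T : Opens ℝ} {D : Data E G}

theorem thetaFn_congr {F F' : ℝ × ℝ → D.Vel} {p : ℝ × ℝ} (h : F =ᶠ[𝓝 p] F') :
    D.thetaFn F p = D.thetaFn F' p := by
  have h1 : (fun q => (F q).1) =ᶠ[𝓝 p] fun q => (F' q).1 := h.fun_comp Prod.fst
  rw [thetaFn, thetaFn, logDeriv_congr h1, h.eq_of_nhds]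

variable [LieGroup 𝓘(ℝ, E) ∞ G]

/-- A curve in `G` can be deformed in the direction of a multiple of a test function. -/
theorem exists_deformation {g : ℝ → G} (hg : ContMDiffOn 𝓘(ℝ, ℝ) 𝓘(ℝ, E) ∞ g T) {f : ℝ → ℝ}
    (hf : ContDiff ℝ ∞ f) (hc : HasCompactSupport f) (v : E) :
    ∃ c : ℝ, 0 < c ∧ ∃ h : ℝ × ℝ → G, ContMDiffOn 𝓘(ℝ, ℝ × ℝ) 𝓘(ℝ, E) ∞ h (strip T) ∧
      (∀ x, h (0, x) = g x) ∧ (∀ s x, f x = 0 → h (s, x) = g x) ∧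
      ∀ x ∈ T, logDeriv E h (0, x) (1, 0) = (c * f x) • v := by
  obtain ⟨r, hr, hball⟩ := Metric.isOpen_iff.1 (isOpen_chartOne_target (E := E) (G := G)) _ origin_mem
  obtain ⟨M, hM⟩ := hf.continuous.bounded_above_of_compact_support hc
  have hM0 : 0 ≤ M := (norm_nonneg _).trans (hM 0)
  have hpos : 0 < M * ‖v‖ + 1 := by positivity
  -- This keeps `c M ‖v‖ < r`, so the displacement stays in a ball inside the chart target; the `1`
  -- avoids division by zero.
  set c : ℝ := r / (M * ‖v‖ + 1) with hcdef
  have hcpos : 0 < c := by positivity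
  -- A variation must be defined for all real parameters; `sin` bounds the displacement and has
  -- derivative `1` at `0`.
  let y : ℝ × ℝ → E := fun p => origin E G + (Real.sin p.1 * (c * f p.2)) • v
  have hy : ContDiff ℝ ∞ y :=
    contDiff_const.add (((Real.contDiff_sin.comp contDiff_fst).mul
      (contDiff_const.mul (hf.comp contDiff_snd))).smul contDiff_const)
  have hmem : ∀ p, y p ∈ (chartOne E G).target := fun p => by
    refine hball ?_
    rw [Metric.mem_ball, dist_eq_norm]
    simp only [y, add_sub_cancel_left, norm_smul, norm_mul]
    have h1 : ‖Real.sin p.1‖ ≤ 1 := Real.abs_sin_le_one _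
    have h2 : ‖c‖ = c := by rw [Real.norm_eq_abs, abs_of_pos hcpos]
    calc ‖Real.sin p.1‖ * (‖c‖ * ‖f p.2‖) * ‖v‖ ≤ 1 * (c * M) * ‖v‖ := by
          rw [h2]; gcongr; exact hM _
      _ = c * (M * ‖v‖) := by ring
      _ < c * (M * ‖v‖ + 1) := by gcongr; linarith
      _ = r := by rw [hcdef]; field_simp
  have hy0 : ∀ x, y (0, x) = origin E G := fun x => by simp [y]
  have hh : ContMDiffOn 𝓘(ℝ, ℝ × ℝ) 𝓘(ℝ, E) ∞ (fun p => g p.2 * (chartOne E G).symm (y p))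
      (strip T) := by
    refine ContMDiffOn.mul (hg.comp contDiff_snd.contMDiff.contMDiffOn fun p hp => hp.2) ?_
    exact (contMDiffOn_extChartAt_symm (1 : G)).comp hy.contMDiff.contMDiffOn fun p _ => hmem p
  refine ⟨c, hcpos, fun p => g p.2 * (chartOne E G).symm (y p), hh, fun x => ?_, fun s x hx => ?_,
    fun x hx => ?_⟩
  · simp only [hy0, chartOne_symm_origin, mul_one]
  · have : y (s, x) = origin E G := by simp [y, hx]
    simp only [this, chartOne_symm_origin, mul_one]
  · have hd := hh.contMDiffAt ((isOpen_strip T).mem_nhds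
      (⟨mem_univ 0, hx⟩ : ((0 : ℝ), x) ∈ strip T))
    have h1 : DifferentiableAt ℝ (fun q : ℝ × ℝ => chartOne E G
        ((g x * (chartOne E G).symm (y (0, x)))⁻¹ * (g q.2 * (chartOne E G).symm (y q)))) (0, x) :=
      (contDiffAt_chart (contMDiffAt_const.mul hd) (by simp)).differentiableAt (by simp)
    refine (hasDerivAt_slice_fst h1).unique ?_
    have h2 : (fun s : ℝ => chartOne E G ((g x * (chartOne E G).symm (y (0, x)))⁻¹ *
        (g x * (chartOne E G).symm (y (s, x))))) = fun s => y (s, x) := by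
      ext1 s
      rw [hy0, chartOne_symm_origin, mul_one, inv_mul_cancel_left, (chartOne E G).right_inv (hmem _)]
    rw [h2]
    have h3 := ((((Real.hasDerivAt_sin 0).mul_const (c * f x)).smul_const v).const_add (origin E G))
    simpa [y] using h3

theorem logDeriv_slice_snd {h : ℝ × ℝ → G} {g : ℝ → G} {s x : ℝ} (hx : x ∈ T)
    (hh : ContMDiffOn 𝓘(ℝ, ℝ × ℝ) 𝓘(ℝ, E) ∞ h (strip T)) (he : ∀ᶠ y in 𝓝 x, h (s, y) = g y) :
    logDeriv E h (s, x) (0, 1) = logDeriv E g x 1 := by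
  have hk : HasFDerivAt (fun y : ℝ => (s, y)) (ContinuousLinearMap.inr ℝ ℝ ℝ) x :=
    (hasFDerivAt_const s _).prodMk (hasFDerivAt_id _)
  have h1 := logDeriv_comp (F := h) (k := fun y : ℝ => (s, y)) (p := x)
    (hh.contMDiffAt ((isOpen_strip T).mem_nhds ⟨mem_univ _, hx⟩)) hk.differentiableAt
  have h2 : (h ∘ fun y : ℝ => (s, y)) =ᶠ[𝓝 x] g := he
  rw [logDeriv_congr h2, hk.fderiv] at h1
  rw [h1]
  simp

/-- The first variation of an extremal in the directions `v` of the group, `a` of `𝔞` and `b` of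
`𝔟`. -/
theorem first_variation [Nonempty T] {γ : T → T × D.Vel} (hγ : γ ∈ (D.problem T).extremals)
    (v : E) (a : D.𝔞) (b : D.𝔟) (t : T) :
    -(vectorVelocity (fun s => D.B (γ s).2.2.1) t v)
      - D.B (γ t).2.2.1 (brCLM G v (pull D.mc γ t + Ad (γ t).2.1⁻¹ ((γ t).2.2.2.1 : E)))
      + D.B (γ t).2.2.1 (Ad (γ t).2.1⁻¹ (a : E) + b) - D.μ a - D.ν b = 0 := by
  obtain ⟨⟨hsec, hθγ⟩, hext⟩ := hγ
  let F₀ : ℝ → D.Vel := fun x => (γ (toTime T x)).2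
  have hF₀ : ContMDiffOn 𝓘(ℝ, ℝ) D.velModel ∞ F₀ T :=
    contMDiffOn_comp_toTime (contMDiff_snd.comp hsec.1)
  have hg₀ := contMDiffOn_group hF₀
  have hJ₀ := contDiffOn_J hF₀
  have hBJ : ContDiffOn ℝ ∞ (fun x => D.B (F₀ x).2.1) T := D.B.contDiff.comp_contDiffOn hJ₀
  have hTo : IsOpen (T : Set ℝ) := T.2
  let q : ℝ → ℝ := fun x => -(deriv (fun y => D.B (F₀ y).2.1) x v)
      - D.B (F₀ x).2.1 (brCLM G v (logDeriv E (fun y => (F₀ y).1) x 1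
          + Ad (F₀ x).1⁻¹ ((F₀ x).2.2.1 : E)))
      + D.B (F₀ x).2.1 (Ad (F₀ x).1⁻¹ (a : E) + b) - D.μ a - D.ν b
  have hq : ContinuousOn q T := by
    have h1 : ContinuousOn (deriv fun y => D.B (F₀ y).2.1) T :=
      hBJ.continuousOn_deriv_of_isOpen hTo (by simp)
    have h2 := (contDiffOn_logDeriv hTo hg₀).continuousOn
    have h3 := (contDiffOn_Ad_inv hTo hg₀).continuousOn
    have h4 := (contDiffOn_α hF₀).continuousOn
    have h5 := hBJ.continuousOn
    exact ((((h1.clm_apply continuousOn_const).neg.sub (h5.clm_apply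
      ((brCLM G v).continuous.comp_continuousOn ((h2.clm_apply continuousOn_const).add
        (h3.clm_apply h4))))).add (h5.clm_apply ((h3.clm_apply continuousOn_const).add
          continuousOn_const))).sub continuousOn_const).sub continuousOn_const
  have hBJs : ContMDiff 𝓘(ℝ, ℝ) 𝓘(ℝ, E →L[ℝ] ℝ) ∞ (fun s => D.B (γ s).2.2.1) :=
    D.B.contDiff.contMDiff.comp
      (contMDiff_fst.comp (contMDiff_snd.comp (contMDiff_snd.comp hsec.1)))
  have h0 := eq_zero_of_integral_test_eq_zero hq ?_ t.2
  · rw [vectorVelocity_eq_deriv hBJs, pull_mc hsec.1]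
    simpa only [q, F₀, toTime_coe] using h0
  intro f hf hcs hsupp
  obtain ⟨c, hc, h, hh, hh0, hhf, hhu⟩ := exists_deformation hg₀ hf hcs v
  have hO := isOpen_strip T
  have hsf : ContDiff ℝ ∞ (fun p : ℝ × ℝ => p.1 * (c * f p.2)) :=
    contDiff_fst.mul (contDiff_const.mul (hf.comp contDiff_snd))
  have hsnd : MapsTo (Prod.snd : ℝ × ℝ → ℝ) (strip T) T := fun p hp => hp.2
  let α : ℝ × ℝ → D.𝔞 := fun p => (F₀ p.2).2.2.1 + (p.1 * (c * f p.2)) • a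
  let β : ℝ × ℝ → D.𝔟 := fun p => (F₀ p.2).2.2.2 + (p.1 * (c * f p.2)) • b
  have hα : ContDiffOn ℝ ∞ α (strip T) :=
    ((contDiffOn_α_subtype hF₀).comp contDiff_snd.contDiffOn hsnd).add
      (hsf.smul contDiff_const).contDiffOn
  have hβ : ContDiffOn ℝ ∞ β (strip T) :=
    ((contDiffOn_β_subtype hF₀).comp contDiff_snd.contDiffOn hsnd).add
      (hsf.smul contDiff_const).contDiffOn
  -- `J` is obtained by solving `θ = 0`, so the family is admissible for arbitrary variations of
  -- `g`, `α` and `β`.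
  let Jf : ℝ × ℝ → E := fun p => logDeriv E h p (0, 1) + Ad (h p)⁻¹ (α p : E) + β p
  have hJf : ContDiffOn ℝ ∞ Jf (strip T) :=
    (((contDiffOn_logDeriv hO hh).clm_apply contDiffOn_const).add
      ((contDiffOn_Ad_inv hO hh).clm_apply (D.𝔞.subtypeL.contDiff.comp_contDiffOn hα))).add
      (D.𝔟.subtypeL.contDiff.comp_contDiffOn hβ)
  let F : ℝ × ℝ → D.Vel := fun p => (h p, Jf p, α p, β p)
  have hF : ContMDiffOn 𝓘(ℝ, ℝ × ℝ) D.velModel ∞ F (strip T) :=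
    hh.prodMk (hJf.contMDiffOn.prodMk (hα.contMDiffOn.prodMk hβ.contMDiffOn))
  have hθF : ∀ p, D.thetaFn F p = 0 := fun p => by
    simp only [thetaFn, F, Jf]
    abel
  let Γ : ℝ → T → T × D.Vel := fun s t => (t, F (s, (t : ℝ)))
  have hΓ : ContMDiff (𝓘(ℝ, ℝ).prod 𝓘(ℝ, ℝ)) D.totalModel ∞ (fun p : ℝ × T => Γ p.1 p.2) :=
    contMDiff_snd.prodMk (contMDiff_of_strip hF)
  have hΓs : ∀ s t, (Γ s t).1 = t := fun _ _ => rfl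
  have hfam : ∀ s (t : T), famVel Γ =ᶠ[𝓝 (s, (t : ℝ))] F := fun s t => by
    filter_upwards [hO.mem_nhds (⟨mem_univ s, t.2⟩ : (s, (t : ℝ)) ∈ strip T)] with p hp
    simp only [famVel, Γ, coe_toTime hp.2]
  have hJγ : ∀ t, (γ t).2.2.1 = pull D.mc γ t + Ad (γ t).2.1⁻¹ ((γ t).2.2.2.1 : E)
      + ((γ t).2.2.2.2 : E) := fun t => by
    have h1 := (pull_θ hsec t).symm.trans (hθγ t)
    rw [sub_eq_zero] at h1
    rw [h1]
    abel
  -- Agreement of `h` near `t`, and not only at `t`, is needed because `Jf` contains the time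
  -- derivative of `h`.
  have hΓeq : ∀ s (t : T), (∀ᶠ y in 𝓝 (t : ℝ), h (s, y) = (F₀ y).1) → s * (c * f t) = 0 →
      Γ s t = γ t := by
    intro s t he hz
    have e1 : h (s, (t : ℝ)) = (γ t).2.1 := by
      simpa only [F₀, toTime_coe] using he.self_of_nhds
    have e2 : α (s, (t : ℝ)) = (γ t).2.2.2.1 := by simp [α, hz, F₀, toTime_coe]
    have e3 : β (s, (t : ℝ)) = (γ t).2.2.2.2 := by simp [β, hz, F₀, toTime_coe]
    have e4 : Jf (s, (t : ℝ)) = (γ t).2.2.1 := by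
      simp only [Jf]
      rw [logDeriv_slice_snd (T := T) t.2 hh he, e1, e2, e3, hJγ t, pull_mc hsec.1]
    have e5 : (γ t).1 = t := hsec.2 t
    simp only [Γ, F, e1, e2, e3, e4]
    exact Prod.ext e5.symm rfl
  have hC := isCompact_preimage_tsupport hcs hsupp
  have hvar : (D.problem T).IsVariation γ (((↑) : T → ℝ) ⁻¹' tsupport f) Γ := by
    refine ⟨hΓ, hΓs, ?_, hC, ?_⟩
    · ext1 t
      exact hΓeq 0 t (Eventually.of_forall hh0) (by simp)
    · intro s t ht
      refine hΓeq s t ?_ (by simp [image_eq_zero_of_notMem_tsupport ht])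
      filter_upwards [(isClosed_tsupport f).isOpen_compl.mem_nhds ht] with y hy
      exact hhf s y (image_eq_zero_of_notMem_tsupport hy)
  have hadm : (D.problem T).IsAdmissible Γ := fun t => by
    have h1 : (fun s => pull (D.problem T).gen (Γ s) t) = fun _ => 0 := by
      ext1 s
      exact (pull_θ_family hΓ hΓs s t).trans ((thetaFn_congr (hfam s t)).trans (hθF _))
    rw [h1]
    exact hasDerivAt_const _ _
  have hact := hext _ Γ hvar hadm
  have hform : ∀ s t, pull (D.problem T).form (Γ s) t = D.L (F (s, (t : ℝ))) := fun s t =>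
    pull_form (isSection_family hΓ hΓs s) t
  -- Boundary term of the integration by parts: `f' J^♭(v) = (f J^♭(v))' - f (J^♭)'(v)`. The common
  -- factor `c` comes from the deformation and was built into the variations of `α` and `β` as well.
  let w : ℝ → ℝ := fun x => f x * D.B (F₀ x).2.1 v
  have hw : ContDiffOn ℝ ∞ w T := hf.contDiffOn.mul (hBJ.clm_apply contDiffOn_const)
  have hint := integral_eq_zero_of_action hC (contDiffOn_L hF) hform
    (d := fun x => c * (deriv w x + f x * q x)) ?_ hact
  · rw [image_preimage_tsupport hsupp, integral_const_mul,
      integral_add] at hint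
    · have h1 : ∫ x in tsupport f, deriv w x = 0 :=
        integral_deriv_eq_zero_of_compact hcs hsupp
          (fun x hx => ((hw.contDiffAt (hTo.mem_nhds hx)).differentiableAt (by simp)).hasDerivAt)
          (hw.continuousOn_deriv_of_isOpen hTo (by simp))
          (fun x _ hx => by simp [w, image_eq_zero_of_notMem_tsupport hx])
      rw [h1, zero_add] at hint
      exact (mul_eq_zero.1 hint).resolve_left hc.ne'
    · exact ((hw.continuousOn_deriv_of_isOpen hTo (by simp)).mono hsupp).integrableOn_compact hcs
    · exact ((hf.continuous.continuousOn.mul hq).mono hsupp).integrableOn_compact hcs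
  intro t _
  have hmem : ((0 : ℝ), (t : ℝ)) ∈ strip T := ⟨mem_univ _, t.2⟩
  have hnhds := hO.mem_nhds hmem
  have hTn : (T : Set ℝ) ∈ 𝓝 (t : ℝ) := hTo.mem_nhds t.2
  have dJ := hasDerivAt_slice_fst (((contDiffOn_J hF).contDiffAt hnhds).differentiableAt (by simp))
  have dα := hasDerivAt_slice_fst (((contDiffOn_α hF).contDiffAt hnhds).differentiableAt (by simp))
  have dβ := hasDerivAt_slice_fst (((contDiffOn_β hF).contDiffAt hnhds).differentiableAt (by simp))
  have hlin : HasDerivAt (fun s : ℝ => s * (c * f t)) (c * f t) 0 := by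
    simpa using (hasDerivAt_id (0 : ℝ)).mul_const (c * f t)
  have eα : fderiv ℝ (fun p => ((F p).2.2.1 : E)) (0, (t : ℝ)) (1, 0) = (c * f t) • (a : E) := by
    refine dα.unique ?_
    simp only [F, α, Submodule.coe_add, Submodule.coe_smul]
    exact (hlin.smul_const (a : E)).const_add _
  have eβ : fderiv ℝ (fun p => ((F p).2.2.2 : E)) (0, (t : ℝ)) (1, 0) = (c * f t) • (b : E) := by
    refine dβ.unique ?_
    simp only [F, β, Submodule.coe_add, Submodule.coe_smul]
    exact (hlin.smul_const (b : E)).const_add _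
  have hL := hasDerivAt_L (D := D) (c := fun s => F (s, (t : ℝ))) dJ dα dβ
  refine hL.congr_deriv ?_
  -- Since `θ` vanishes along the whole family, its computed parameter derivative is zero, which
  -- determines the variation of `J`.
  have hθ := (hasDerivAt_thetaFn hF (s := 0) t.2).unique
    (by simp only [hθF]; exact hasDerivAt_const _ _)
  have hF0 : F (0, (t : ℝ)) = F₀ t := by
    have := congrArg Prod.snd (hΓeq 0 t (Eventually.of_forall hh0) (by simp))
    simpa only [F₀, toTime_coe] using this
  have hdu : deriv (fun y => logDeriv E (fun q => (F q).1) (0, y) (1, 0)) (t : ℝ) =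
      (c * deriv f t) • v := by
    have h1 : (fun y => logDeriv E (fun q => (F q).1) (0, y) (1, 0)) =ᶠ[𝓝 (t : ℝ)]
        fun y => (c * f y) • v := by
      filter_upwards [hTn] with y hy
      exact hhu y hy
    rw [h1.deriv_eq]
    exact ((((hf.differentiable (by simp)) (t : ℝ)).hasDerivAt.const_mul c).smul_const v).deriv
  have hu : logDeriv E (fun q => (F q).1) (0, (t : ℝ)) (1, 0) = (c * f t) • v := hhu t t.2
  have hwt : logDeriv E (fun q => (F q).1) (0, (t : ℝ)) (0, 1) =
      logDeriv E (fun y => (F₀ y).1) t 1 :=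
    logDeriv_slice_snd (T := T) t.2 hh (Eventually.of_forall hh0)
  rw [hdu, hu, hwt, eα, eβ, hF0, sub_eq_zero] at hθ
  have hdw : deriv w t = deriv f t * D.B (F₀ t).2.1 v
      + f t * deriv (fun y => D.B (F₀ y).2.1) t v := by
    have h1 := ((hBJ.contDiffAt hTn).differentiableAt (by simp)).hasDerivAt.clm_apply
      (hasDerivAt_const (t : ℝ) v)
    have h2 := ((hf.differentiable (by simp)) (t : ℝ)).hasDerivAt.mul h1
    refine h2.deriv.trans ?_
    simp
  rw [← hθ, eα, eβ, hF0, hdw]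
  simp only [q, map_add, map_sub, map_smul, smul_eq_mul, smul_apply]
  ring

end Data

/-! ### The lift `σ = J^♭`, the canonical fibres, and the two systems of equations. -/

namespace Data

variable {E : Type*} [NormedAddCommGroup E] [NormedSpace ℝ E]
  {G : Type*} [TopologicalSpace G] [ChartedSpace E G] [Group G]
  {T : Opens ℝ} {D : Data E G}

/-- The lift of a section with multiplier `σ = J^♭`. -/
def flatLift (γ : T → T × D.Vel) (t : T) : (T × D.Vel) × (E →L[ℝ] ℝ) := (γ t, D.B (γ t).2.2.1)

theorem isSection_flatLift {γ : T → T × D.Vel} (hγ : (D.problem T).IsSection γ) :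
    (D.problem T).lepage.IsSection (flatLift γ) :=
  ⟨hγ.1.prodMk (D.B.contDiff.contMDiff.comp
    (contMDiff_fst.comp (contMDiff_snd.comp (contMDiff_snd.comp hγ.1)))), hγ.2⟩

theorem isLepageEquivalent_lepage (D : Data E G) (T : Opens ℝ) :
    (D.problem T).IsLepageEquivalent (D.problem T).lepage Prod.fst where
  gen_eq_zero := rfl
  smooth := contMDiff_fst
  surjective := Prod.fst_surjective
  submersion y := by
    rw [mfderiv_fst]
    exact fun v => ⟨(v, 0), rfl⟩
  proj_eq _ := rfl
  pull_eq γ hγ hint t := by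
    rw [VariationalProblem.pull_lepage_form _ hγ.1, hint.2 t, map_zero, add_zero]

variable [LieGroup 𝓘(ℝ, E) ∞ G]

/-- Vectors tangent to `G` are annihilated by `dt`, and on them `θ` is the Maurer–Cartan form, an
isomorphism. This is what makes the multiplier unique. -/
theorem θ_surjective (D : Data E G) (x : T × D.Vel) (v : E) :
    ∃ w : TangentSpace D.totalModel x, D.θ x w = v := by
  have h1 : mfderiv D.totalModel 𝓘(ℝ, E) (fun y : T × D.Vel => y.2.1) x =
      (ContinuousLinearMap.fst ℝ E (E × D.𝔞 × D.𝔟)) ∘L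
        (ContinuousLinearMap.snd ℝ ℝ (E × E × D.𝔞 × D.𝔟)) := by
    have h2 := HasMFDerivAt.comp x (hasMFDerivAt_fst (I := 𝓘(ℝ, E))
      (I' := 𝓘(ℝ, E).prod (𝓘(ℝ, D.𝔞).prod 𝓘(ℝ, D.𝔟))) x.2)
      (hasMFDerivAt_snd (I := 𝓘(ℝ, ℝ)) (I' := D.velModel) x)
    exact h2.mfderiv
  have h2 : mfderiv D.totalModel 𝓘(ℝ, ℝ) (fun y : T × D.Vel => (y.1 : ℝ)) x =
      (mfderiv 𝓘(ℝ, ℝ) 𝓘(ℝ, ℝ) ((↑) : T → ℝ) x.1 : ℝ →L[ℝ] ℝ) ∘L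
        (ContinuousLinearMap.fst ℝ ℝ (E × E × D.𝔞 × D.𝔟)) := by
    have h3 : MDifferentiableAt 𝓘(ℝ, ℝ) 𝓘(ℝ, ℝ) ((↑) : T → ℝ) x.1 :=
      (contMDiff_subtype_val (n := ∞)).mdifferentiableAt (by simp)
    exact (HasMFDerivAt.comp x h3.hasMFDerivAt
      (hasMFDerivAt_fst (I := 𝓘(ℝ, ℝ)) (I' := D.velModel) x)).mfderiv
  let v' : E := mulInvariantVectorField (I := 𝓘(ℝ, E)) (G := G) v x.2.1
  refine ⟨((0, v', 0) : ℝ × E × E × D.𝔞 × D.𝔟), ?_⟩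
  have e1 : D.mc x ((0, v', 0) : ℝ × E × E × D.𝔞 × D.𝔟) = v := by
    refine Eq.trans ?_ (maurerCartan_mulInvariantVectorField
      (v : GroupLieAlgebra 𝓘(ℝ, E) G) x.2.1)
    exact congrArg (maurerCartan x.2.1 : E →L[ℝ] E)
      (DFunLike.congr_fun h1 ((0, v', 0) : ℝ × E × E × D.𝔞 × D.𝔟))
  have e2 : D.dt x ((0, v', 0) : ℝ × E × E × D.𝔞 × D.𝔟) = 0 :=
    (DFunLike.congr_fun h2 ((0, v', 0) : ℝ × E × E × D.𝔞 × D.𝔟)).trans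
      (map_zero (mfderiv 𝓘(ℝ, ℝ) 𝓘(ℝ, ℝ) ((↑) : T → ℝ) x.1 : ℝ →L[ℝ] ℝ))
  change D.mc x _ - (D.dt x _) • _ = v
  rw [e1, e2, zero_smul, sub_zero]

theorem bijOn_lepagePoint (D : Data E G) (T : Opens ℝ) (x : T × D.Vel) :
    BijOn ((D.problem T).lepagePoint x) univ ((D.problem T).lepageFiber x) := by
  refine ⟨?_, ?_, ?_⟩
  · intro σ _
    exact ⟨σ ∘L (D.problem T).gen x, Submodule.subset_span ⟨σ, rfl⟩, rfl⟩
  · intro σ _ τ _ h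
    ext v
    obtain ⟨w, rfl⟩ := θ_surjective D x v
    exact DFunLike.congr_fun (add_left_cancel h) w
  · rintro _ ⟨β, hβ, rfl⟩
    suffices h : ∃ σ : E →L[ℝ] ℝ, β = σ ∘L (D.problem T).gen x by
      obtain ⟨σ, rfl⟩ := h
      exact ⟨σ, mem_univ _, rfl⟩
    induction hβ using Submodule.span_induction with
    | mem β h => obtain ⟨σ, rfl⟩ := h; exact ⟨σ, rfl⟩
    | zero => exact ⟨0, by ext; rfl⟩
    | add β β' _ _ h h' =>
      obtain ⟨σ, rfl⟩ := h
      obtain ⟨σ', rfl⟩ := h'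
      exact ⟨σ + σ', by ext; rfl⟩
    | smul c β _ h =>
      obtain ⟨σ, rfl⟩ := h
      exact ⟨c • σ, by ext; rfl⟩

theorem eq_flatLift_of_mem_lepage_extremals {γ : T → (T × D.Vel) × (E →L[ℝ] ℝ)}
    (hγ : γ ∈ (D.problem T).lepage.extremals) : γ = flatLift (Prod.fst ∘ γ) := by
  ext1 t
  exact Prod.ext rfl (constraints_of_lepage_extremal hγ t).2.symm

variable [FiniteDimensional ℝ E]

/-- The three independent directions of `first_variation` give one equation each: `v` the evolution
of `σ`, `a` the `𝔟⁰` component, `b` the `𝔞⁰` component. -/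
theorem flatLift_mem_hamiltonSolutions {γ : T → T × D.Vel} (hγ : γ ∈ (D.problem T).extremals) :
    flatLift γ ∈ D.hamiltonSolutions T := by
  have : CompleteSpace E := FiniteDimensional.complete ℝ E
  refine ⟨isSection_flatLift hγ.1.1, fun t => ?_⟩
  have : Nonempty T := ⟨t⟩
  refine ⟨fun ξ => ?_, sub_self _, hγ.1.2 t, (projB0_sub_eq_zero_iff _).2 fun a => ?_,
    (projA0_sub_eq_zero_iff _).2 fun b => ?_⟩
  · have h := first_variation hγ ξ 0 0 t
    simp only [Submodule.coe_zero, map_zero, add_zero, sub_zero] at h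
    rw [adSharp_eq]
    change vectorVelocity (fun s => D.B (γ s).2.2.1) t ξ + D.B (γ t).2.2.1
      (brCLM G ξ (pull D.mc γ t + Ad (γ t).2.1⁻¹ ((γ t).2.2.2.1 : E))) = 0
    linarith
  · have h := first_variation hγ 0 a 0 t
    simp only [Submodule.coe_zero, map_zero, zero_apply, add_zero, sub_zero, neg_zero,
      zero_add] at h
    exact sub_eq_zero.1 h
  · have h := first_variation hγ 0 0 b t
    simp only [Submodule.coe_zero, map_zero, zero_apply, sub_zero, neg_zero, zero_add] at h
    exact sub_eq_zero.1 h

/-- No group variation upstairs is needed for the forward inclusion: an extremal is the `J^♭` lift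
of its projection, which is an extremal of the constrained problem. -/
theorem lepage_extremals_eq (D : Data E G) (T : Opens ℝ) :
    (D.problem T).lepage.extremals = D.hamiltonSolutions T := by
  refine Subset.antisymm (fun γ hγ => ?_) hamiltonSolutions_subset
  rw [eq_flatLift_of_mem_lepage_extremals hγ]
  exact flatLift_mem_hamiltonSolutions (fst_comp_mem_extremals hγ)

/-- The Euler-Lagrange equations are the Hamiltonian system for the multiplier `σ = J^♭`. -/
theorem flatLift_mem_hamiltonSolutions_iff {γ : T → T × D.Vel} :
    flatLift γ ∈ D.hamiltonSolutions T ↔ γ ∈ D.eulerLagrangeSolutions T := by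
  have : CompleteSpace E := FiniteDimensional.complete ℝ E
  have key : (D.problem T).IsSection γ → ∀ t, pull D.θ γ t = 0 → ∀ ξ,
      adSharp G (pull D.mc γ t + Ad (γ t).2.1⁻¹ ((γ t).2.2.2.1 : E)) (D.B (γ t).2.2.1) ξ =
        -adSharp G ((γ t).2.2.2.2 : E) (D.B (γ t).2.2.1) ξ := by
    intro hsec t hθ ξ
    rw [pull_θ hsec, sub_eq_zero] at hθ
    have h1 : pull D.mc γ t + Ad (γ t).2.1⁻¹ ((γ t).2.2.2.1 : E) =
        (γ t).2.2.1 - ((γ t).2.2.2.2 : E) := by rw [hθ]; abel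
    -- Invariance removes the `J` part of `J - β`, leaving minus the coadjoint term of `β`.
    have h2 := D.invariant (γ t).2.2.1 ξ
    rw [adSharp_eq] at h2 ⊢
    rw [h1, adSharp_eq, map_sub, map_sub, h2, zero_sub]
  constructor
  · rintro ⟨hsec, h⟩
    have hsec1 := isSection_fst hsec
    refine ⟨hsec1, fun t => ?_⟩
    obtain ⟨h1, -, h3, h4, h5⟩ := h t
    refine ⟨fun ξ => ?_, h3, h4, h5⟩
    rw [sub_eq_add_neg, ← key hsec1 t h3 ξ]
    exact h1 ξ
  · rintro ⟨hsec, h⟩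
    refine ⟨isSection_flatLift hsec, fun t => ?_⟩
    obtain ⟨h1, h3, h4, h5⟩ := h t
    refine ⟨fun ξ => ?_, sub_self _, h3, h4, h5⟩
    refine Eq.trans (congrArg _ (key hsec t h3 ξ)) ?_
    rw [← sub_eq_add_neg]
    exact h1 ξ

end Data

end AKS

end

open scoped Manifold ContDiff in
theorem mainTheorem5 {E : Type*} [NormedAddCommGroup E] [NormedSpace ℝ E] [FiniteDimensional ℝ E]
    {G : Type*} [TopologicalSpace G] [ChartedSpace E G] [Group G] [LieGroup 𝓘(ℝ, E) ∞ G]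
    (D : AKS.Data E G) (T : TopologicalSpace.Opens ℝ) :
    (D.problem T).IsLepageEquivalent (D.problem T).lepage Prod.fst ∧
    (∀ x, Set.BijOn ((D.problem T).lepagePoint x) Set.univ ((D.problem T).lepageFiber x)) ∧
    (D.problem T).IsBivariant (D.problem T).lepage Prod.fst ∧
    Set.BijOn (fun γ => Prod.fst ∘ γ) (D.problem T).lepage.extremals (D.problem T).extremals ∧
    (D.problem T).lepage.extremals = D.hamiltonSolutions T ∧
    (D.problem T).extremals = D.eulerLagrangeSolutions T := by
  have hlift : ∀ γ ∈ (D.problem T).extremals,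
      AKS.Data.flatLift γ ∈ (D.problem T).lepage.extremals := fun γ hγ =>
    AKS.Data.hamiltonSolutions_subset (AKS.Data.flatLift_mem_hamiltonSolutions hγ)
  refine ⟨AKS.Data.isLepageEquivalent_lepage D T, AKS.Data.bijOn_lepagePoint D T,
    ⟨fun γ hγ => AKS.Data.fst_comp_mem_extremals hγ, fun γ hγ => ⟨_, hlift γ hγ, rfl⟩⟩,
    ⟨fun γ hγ => AKS.Data.fst_comp_mem_extremals hγ, fun γ hγ γ' hγ' h => ?_,
      fun γ hγ => ⟨_, hlift γ hγ, rfl⟩⟩, AKS.Data.lepage_extremals_eq D T, ?_⟩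
  · rw [AKS.Data.eq_flatLift_of_mem_lepage_extremals hγ,
      AKS.Data.eq_flatLift_of_mem_lepage_extremals hγ']
    exact congrArg AKS.Data.flatLift h
  · ext γ
    rw [← AKS.Data.flatLift_mem_hamiltonSolutions_iff]
    exact ⟨AKS.Data.flatLift_mem_hamiltonSolutions, fun h =>
      AKS.Data.fst_comp_mem_extremals (AKS.Data.hamiltonSolutions_subset h)⟩
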